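/- Let $\mathcal N\subset\mathcal H\subset\mathcal N'$ be a real Gelfand triple: $\mathcal H=\mathcal H_0$ is a separable real Hilbert space, and $\mathcal N$ is a separable nuclear space, the projective limit of real Hilbert spaces $\mathcal H_p\subset\mathcal H_0$ ($p\in\mathbb N$) with norms $|\cdot|_p\ge|\cdot|_0$, dense in each of them, such that any $\mathcal H_{p_1},\mathcal H_{p_2}$ contain some $\mathcal H_p$ with Hilbert–Schmidt embeddings. Let $\mathcal H_{-p}\subset\mathcal N'$ be the dual of $\mathcal H_p$, with norm $|\cdot|_{-p}$ (put $|x|_{-p}=\infty$ for $x\in\mathcal N'\setminus\mathcal H_{-p}$), let a subscript $\mathbf c$ denote complexification, and let $\mu$ be the Gaussian measure on the cylinder $\sigma$-algebra of $\mathcal N'$ with $\int e^{i\langle x,\eta\rangle}\,d\mu(x)=e^{-|\eta|_0^2/2}$, $\eta\in\mathcal N$. For $\varphi\in L^2(\mu)$ with chaos decomposition $\varphi=\sum_n\langle{:}x^{\otimes n}{:},\varphi^{(n)}\rangle$, where $\varphi^{(n)}$ is in the symmetric tensor power $\mathcal H_{\mathbf c}^{\hat\otimes n}$, put $$\|\varphi\|_{p,q,1}^2=\sum_{n=0}^\infty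 (n!)^2\,2^{nq}\,|\varphi^{(n)}|_p^2 ,$$ where $|\cdot|_p$ is the norm of $\mathcal H_{p,\mathbf c}^{\hat\otimes n}$ (and $\infty$ off this space), and let $(\mathcal N)^1$ be the set of all $\varphi\in L^2(\mu)$ with $\|\varphi\|_{p,q,1}<\infty$ for all $p,q\in\mathbb N$. A pointwise version of $\varphi$ is a function on $\mathcal N'$ that is $\mu$-a.e. equal to $\varphi$ and is the restriction of an entire function $u$ on $\mathcal N'_{\mathbf c}$ of first order of growth and minimal type (for all $p\in\mathbb N$ and $\varepsilon>0$ there is a $C$ with $|u(z)|\le Ce^{\varepsilon|z|_{-p}}$ for all $z\in\mathcal H_{-p,\mathbf c}$). Then every $\varphi\in(\mathcal N)^1$ has a pointwise version. Moreover, for every pointwise version of $\varphi$, again denoted by $\varphi$, every $p$ such that the embedding $\mathcal H_p\to\mathcal H_0$ is Hilbert–Schmidt, and every real $q\ge0$, with $\varepsilon=2^{-q/2}$, $$C_{p,\varepsilon}:=\int_{\mathcal N'}e^{\varepsilon|x|_{-p}}\,d\mu(x)<\infty \qquad\text{and}\qquad |\varphi(x)|\le C_{p,\varepsilon}\,\|\varphi\|_{p,q,1}\,e^{\varepsilon|x|_{-p}}\quad\text{for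 all }x\in\mathcal H_{-p}.$$ -/

import Mathlib

open MeasureTheory Filter Topology
open scoped ENNReal

noncomputable section

namespace GaussianAnalysis

/-- Squared Hilbert-Schmidt norm of an `n`-linear form `f : E × ⋯ × E → ℂ` on a real Hilbert space:
the supremum over finite orthonormal systems `e` of `∑ |f (e_{i₁}, …, e_{iₙ})|²`
(which is the sum over any Hilbert basis when `f` is continuous, and `∞` when `f` is not).
The `n`-linear forms with finite norm are the usual model of the `n`-fold Hilbert tensor power of
the complexification of `E`: a tensor `F` is the form
`(h₁, …, hₙ) ↦ ⟨F, h₁ ⊗ ⋯ ⊗ hₙ⟩`, with the bilinear extension of the inner product of `E`. -/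
def hsNormSq {E : Type*} [NormedAddCommGroup E] [InnerProductSpace ℝ E] {n : ℕ}
    (f : MultilinearMap ℝ (fun _ : Fin n => E) ℂ) : ℝ≥0∞ :=
  ⨆ (m : ℕ) (e : Fin m → E) (_ : Orthonormal ℝ e),
    ∑ i : Fin n → Fin m, ‖f (fun k => e (i k))‖ₑ ^ 2

/-- The form that represents the tensor power `η ⊗ ⋯ ⊗ η`. -/
def tensorPow {E : Type*} [NormedAddCommGroup E] [InnerProductSpace ℝ E] (η : E) (n : ℕ) :
    MultilinearMap ℝ (fun _ : Fin n => E) ℂ :=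
  (MultilinearMap.mkPiAlgebra ℝ (Fin n) ℂ).compLinearMap
    (fun _ => (Complex.ofRealCLM.comp (innerSL ℝ η)).toLinearMap)

/-- Hilbert-Schmidt operators between real Hilbert spaces. -/
def IsHilbertSchmidt {E F : Type*} [NormedAddCommGroup E] [InnerProductSpace ℝ E]
    [NormedAddCommGroup F] [InnerProductSpace ℝ F] (A : E →L[ℝ] F) : Prop :=
  ∃ C : ℝ, ∀ (m : ℕ) (e : Fin m → E), Orthonormal ℝ e → ∑ i, ‖A (e i)‖ ^ 2 ≤ C

/-- The real dual space `N'`. -/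
def TestDual (N : Type*) [AddCommGroup N] [Module ℝ N] [TopologicalSpace N] : Type _ :=
  N →L[ℝ] ℝ

section Dual

variable {N : Type*} [AddCommGroup N] [Module ℝ N] [TopologicalSpace N]

instance : FunLike (TestDual N) N ℝ := inferInstanceAs (FunLike (N →L[ℝ] ℝ) N ℝ)

/-- The σ-algebra generated by the cylinder sets. -/
instance : MeasurableSpace (TestDual N) :=
  ⨆ ξ : N, MeasurableSpace.comap (fun x : TestDual N => x ξ) (borel ℝ)

/-- The complexification of `N'` is the complex vector space of continuous real-linear maps
`N → ℂ`; this is the inclusion of `N'` in it. -/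
def TestDual.toComplex (x : TestDual N) : N →L[ℝ] ℂ :=
  Complex.ofRealCLM.comp (show N →L[ℝ] ℝ from x)

/-- Real part of an element of the complexification of `N'`. -/
def rePart (z : N →L[ℝ] ℂ) : TestDual N := Complex.reCLM.comp z

/-- Imaginary part of an element of the complexification of `N'`. -/
def imPart (z : N →L[ℝ] ℂ) : TestDual N := Complex.imCLM.comp z

end Dual

/-- A Gelfand triple `N ⊂ H 0 ⊂ N'` (with central Hilbert space `H 0`), where `N` is the projective
limit of a family of Hilbert spaces `H p ⊂ H 0`, directed by Hilbert-Schmidt embeddings. -/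
structure NuclearTriple (N : Type*) [AddCommGroup N] [Module ℝ N] [TopologicalSpace N]
    (H : ℕ → Type*) [∀ p, NormedAddCommGroup (H p)] [∀ p, InnerProductSpace ℝ (H p)]
    [∀ p, CompleteSpace (H p)] where
  /-- the embedding of `H p` in `H 0` -/
  incl : ∀ p, H p →L[ℝ] H 0
  /-- the embedding of `N` in `H p` -/
  emb : ∀ p, N →L[ℝ] H p
  incl_injective : ∀ p, Function.Injective (incl p)
  incl_zero : incl 0 = ContinuousLinearMap.id ℝ (H 0)
  norm_incl_le : ∀ p h, ‖incl p h‖ ≤ ‖h‖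
  incl_emb : ∀ p ξ, incl p (emb p ξ) = emb 0 ξ
  emb_injective : Function.Injective (emb 0)
  emb_dense : ∀ p, DenseRange (emb p)
  /-- as a set, `N` is the intersection of all the `H p` -/
  exists_emb : ∀ h : H 0, (∀ p, h ∈ Set.range (incl p)) → ∃ ξ : N, emb 0 ξ = h
  /-- `N` carries the projective limit topology -/
  topology_eq : (inferInstance : TopologicalSpace N) =
    ⨅ p, TopologicalSpace.induced (emb p) inferInstance
  separable : TopologicalSpace.SeparableSpace N
  directed : ∀ p₁ p₂, ∃ p, ∃ k₁ : H p →L[ℝ] H p₁, ∃ k₂ : H p →L[ℝ] H p₂,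
    (∀ h, incl p₁ (k₁ h) = incl p h) ∧ (∀ h, incl p₂ (k₂ h) = incl p h) ∧
    IsHilbertSchmidt k₁ ∧ IsHilbertSchmidt k₂

namespace NuclearTriple

variable {N : Type*} [AddCommGroup N] [Module ℝ N] [TopologicalSpace N]
  {H : ℕ → Type*} [∀ p, NormedAddCommGroup (H p)] [∀ p, InnerProductSpace ℝ (H p)]
  [∀ p, CompleteSpace (H p)] (S : NuclearTriple N H)

/-- The norm `|x|_{-p}` of `x ∈ N'`, equal to `∞` when `x` is not in `H_{-p}`. -/
def dualNorm (p : ℕ) (x : TestDual N) : ℝ≥0∞ :=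
  ⨆ (ξ : N) (_ : ‖S.emb p ξ‖ ≤ 1), ‖x ξ‖ₑ

/-- The norm `|z|_{-p}` on the complexification of `N'`, equal to `∞` off that of `H_{-p}`. -/
def dualNormC (p : ℕ) (z : N →L[ℝ] ℂ) : ℝ≥0∞ :=
  (S.dualNorm p (rePart z) ^ 2 + S.dualNorm p (imPart z) ^ 2) ^ (1 / 2 : ℝ)

/-- Entire functions on the complexification of `N'`: entire on every complex line and locally
bounded (for the inductive limit topology: locally bounded on every step `H_{-p}`). -/
def IsEntire (u : (N →L[ℝ] ℂ) → ℂ) : Prop :=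
  (∀ y z : N →L[ℝ] ℂ, Differentiable ℂ (fun t : ℂ => u (y + t • z))) ∧
  ∀ (p : ℕ) (y : N →L[ℝ] ℂ), S.dualNormC p y < ⊤ →
    ∃ r > 0, ∃ C : ℝ, ∀ z, S.dualNormC p (z - y) < r → ‖u z‖ ≤ C

/-- Entire functions of first order of growth and minimal type. -/
def IsEntireMinType (u : (N →L[ℝ] ℂ) → ℂ) : Prop :=
  S.IsEntire u ∧ ∀ (p : ℕ) (ε : ℝ), 0 < ε → ∃ C : ℝ, ∀ z, S.dualNormC p z < ⊤ →
    ‖u z‖ ≤ C * Real.exp (ε * (S.dualNormC p z).toReal)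

/-- `μ` is the canonical Gaussian measure on `N'`. -/
def IsCanonicalGaussian (μ : Measure (TestDual N)) : Prop :=
  IsProbabilityMeasure μ ∧ ∀ η : N,
    ∫ x, Complex.exp (Complex.I * (x η : ℂ)) ∂μ = (Real.exp (-(1 / 2) * ‖S.emb 0 η‖ ^ 2) : ℂ)

/-- The Wick power `⟨:x^{⊗n}:, ξ^{⊗n}⟩`, a Hermite polynomial in `⟨x, ξ⟩`. -/
def wickPow (ξ : N) (n : ℕ) (x : TestDual N) : ℝ :=
  ∑ k ∈ Finset.range (n / 2 + 1), (n.factorial : ℝ) / ((k.factorial : ℝ) * ((n - 2 * k).factorial : ℝ)) *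
    (-(1 / 2) * ‖S.emb 0 ξ‖ ^ 2) ^ k * (x ξ) ^ (n - 2 * k)

/-- `f` is in the `n`-fold symmetric tensor power of the complexification of `H 0`, and `F` is the
element `⟨:x^{⊗n}:, f⟩` of `L²(μ)`: the pair `(f, F)` is a limit, in the Hilbert tensor power times
`L²(μ)`, of finite linear combinations of pairs `(ξ^{⊗n}, ⟨:x^{⊗n}:, ξ^{⊗n}⟩)`, `ξ ∈ N`. -/
def IsWickMonomial (μ : Measure (TestDual N)) {n : ℕ}
    (f : MultilinearMap ℝ (fun _ : Fin n => H 0) ℂ) (F : Lp ℂ 2 μ) : Prop :=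
  ∀ δ : ℝ≥0∞, 0 < δ → ∃ (m : ℕ) (c : Fin m → ℂ) (ξ : Fin m → N),
    hsNormSq (f - ∑ j, c j • tensorPow (S.emb 0 (ξ j)) n) < δ ∧
    eLpNorm (fun x => F x - ∑ j, c j * (S.wickPow (ξ j) n x : ℂ)) 2 μ < δ

/-- `φ = ∑ₙ ⟨:x^{⊗n}:, f n⟩` is the chaos decomposition of `φ ∈ L²(μ)`. -/
def HasChaos (μ : Measure (TestDual N)) (φ : Lp ℂ 2 μ)
    (f : (n : ℕ) → MultilinearMap ℝ (fun _ : Fin n => H 0) ℂ) : Prop :=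
  ∃ F : ℕ → Lp ℂ 2 μ, (∀ n, S.IsWickMonomial μ (f n) (F n)) ∧ HasSum F φ

/-- The squared norm `|f|_p²` of a kernel `f` of degree `n`: the squared norm of the `g` in the
tensor power of `H p` which the embedding `H p ⊂ H 0` (to the tensor power `n`) maps to `f`, and
`∞` when `f` is not in the tensor power of `H p`. -/
def kernelNormSq (p : ℕ) {n : ℕ} (f : MultilinearMap ℝ (fun _ : Fin n => H 0) ℂ) : ℝ≥0∞ :=
  ⨅ (g : MultilinearMap ℝ (fun _ : Fin n => H p) ℂ)
    (_ : f = g.compLinearMap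
      (fun _ => (ContinuousLinearMap.adjoint (S.incl p)).toLinearMap)), hsNormSq g

/-- `‖φ‖²_{p,q,1} = ∑ₙ (n!)² 2^{nq} |φ⁽ⁿ⁾|_p²`, in terms of the chaos kernels `f n = φ⁽ⁿ⁾`. -/
def testNormSq (p : ℕ) (q : ℝ)
    (f : (n : ℕ) → MultilinearMap ℝ (fun _ : Fin n => H 0) ℂ) : ℝ≥0∞ :=
  ∑' n : ℕ, (n.factorial : ℝ≥0∞) ^ 2 * (2 : ℝ≥0∞) ^ ((n : ℝ) * q) * S.kernelNormSq p (f n)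

/-- `φ` is in the test function space `(N)¹`, with chaos kernels `f n`. -/
def IsTestFunction (μ : Measure (TestDual N)) (φ : Lp ℂ 2 μ)
    (f : (n : ℕ) → MultilinearMap ℝ (fun _ : Fin n => H 0) ℂ) : Prop :=
  S.HasChaos μ φ f ∧ ∀ p q : ℕ, S.testNormSq p q f < ⊤

/-- The restriction of `u` to `N'` is the pointwise defined version of `φ`. -/
def IsPointwiseVersion (μ : Measure (TestDual N)) (φ : Lp ℂ 2 μ) (u : (N →L[ℝ] ℂ) → ℂ) : Prop :=
  S.IsEntireMinType u ∧ ∀ᵐ x ∂μ, u x.toComplex = φ x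

/-- `C_{p,ε} = ∫ e^{ε |x|_{-p}} dμ(x)`, with `e^∞ = ∞`. -/
def expConst (μ : Measure (TestDual N)) (p : ℕ) (ε : ℝ) : ℝ≥0∞ :=
  ∫⁻ x, EReal.exp ((ε : EReal) * (S.dualNorm p x : EReal)) ∂μ

end NuclearTriple

end GaussianAnalysis

end

/-! Let g_n be the tensor over `H p` that represents φ⁽ⁿ⁾. One term of the series for ‖φ‖²_{p,q,1}
gives |g_n| ≤ ‖φ‖_{p,q,1} εⁿ/n! with ε = 2^{-q/2}. Hence G(z) = ∑ ⟨z^{⊗n}, g_n⟩ is entire on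
H_{-p,c} with |G(z)| ≤ ‖φ‖_{p,q,1} e^{ε|z|_{-p}} (`isExpBounded_kernelSeries`). Wick ordering is
Gaussian averaging in imaginary directions, :x^{⊗n}: = ∫ (x+iy)^{⊗n} dμ(y), so the candidate version
is U(x) = ∫ G(x+iy) dμ(y). The triangle inequality for |x+iy|_{-p} then gives the claimed bound with
exactly the constant C_{p,ε} (`IsExpBounded.norm_imAverage_le`). That constant is finite because
Jensen's inequality, applied to a convex combination of squared standard Gaussians, makes
e^{δ|x|²_{-p}} integrable for a small δ > 0.

To see that U = φ almost everywhere, compare S-transforms, the pairings with e^{⟨x,η⟩-|η|₀²/2}. By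
Cameron-Martin the S-transform of U at η is ∫∫ G(η+x+iy) dμ(x) dμ(y). Since μ × μ is invariant under
rotations, the mean value property makes this G(η) (`IsExpBounded.integral_imAverage_shift`). The
same computation for monomials gives the S-transform of Wick powers, and by L²-continuity that of φ,
which is also G(η) (`HasChaos.hasSum_integral_mul_exp`). The exponentials are total in L²(μ), so U =
φ.

Finally, balls of H_{-p} have positive measure, so entire functions on H_{-p,c} that agree almost
everywhere on the real points coincide (`IsEntireOn.eq_of_ae`). Therefore the functions U for
different p glue to one function on N'_c, of minimal type because q is arbitrary, and every other
pointwise version agrees with U on H_{-p}, so it inherits the bound. -/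

noncomputable section

namespace GaussianAnalysis

/-! ### Identity theorem and holomorphic parameter integrals in one variable. -/

section Analytic

/-- Entire functions that agree on the real multiples of `c ≠ 0` are equal. -/
theorem entire_eq_of_eq_on_line {f g : ℂ → ℂ} (hf : Differentiable ℂ f) (hg : Differentiable ℂ g)
    {c : ℂ} (hc : c ≠ 0) (h : ∀ s : ℝ, f (s * c) = g (s * c)) : f = g := by
  have hf' : AnalyticOnNhd ℂ f Set.univ := hf.differentiableOn.analyticOnNhd isOpen_univ
  have hg' : AnalyticOnNhd ℂ g Set.univ := hg.differentiableOn.analyticOnNhd isOpen_univ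
  refine hf'.eq_of_frequently_eq hg' (z₀ := 0) ?_
  have ht : Tendsto (fun s : ℝ => (s : ℂ) * c) (𝓝[≠] 0) (𝓝[≠] 0) := by
    refine tendsto_nhdsWithin_of_tendsto_nhds_of_eventually_within _ ?_ ?_
    · have : Continuous fun s : ℝ => (s : ℂ) * c := by fun_prop
      simpa using (this.tendsto 0).mono_left nhdsWithin_le_nhds
    · filter_upwards [self_mem_nhdsWithin] with s hs
      simpa [hc] using hs
  exact ht.frequently (Eventually.of_forall h).frequently

/-- Holomorphy of integrals depending on a parameter. -/
theorem differentiable_integral_of_dominated {Ω : Type*} [MeasurableSpace Ω] {μ : Measure Ω}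
    {F : ℂ → Ω → ℂ} (hm : ∀ t, AEStronglyMeasurable (F t) μ)
    (hd : ∀ᵐ ω ∂μ, Differentiable ℂ fun t => F t ω)
    (hb : ∀ R : ℝ, ∃ B : Ω → ℝ, Integrable B μ ∧ ∀ᵐ ω ∂μ, ∀ t : ℂ, ‖t‖ ≤ R → ‖F t ω‖ ≤ B ω) :
    Differentiable ℂ fun t => ∫ ω, F t ω ∂μ := by
  intro t₀
  -- The radius leaves room for t in the unit ball about t₀ and a unit circle about t, on which
  -- Cauchy's estimate bounds the derivative by `B`.
  obtain ⟨B, hBi, hB⟩ := hb (‖t₀‖ + 2)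
  have hint : Integrable (F t₀) μ := by
    refine hBi.mono' (hm t₀) ?_
    filter_upwards [hB] with ω h using h t₀ (by linarith)
  have hmeas : AEStronglyMeasurable (fun ω => deriv (fun t => F t ω) t₀) μ := by
    refine aestronglyMeasurable_of_tendsto_ae atTop
      (f := fun (n : ℕ) ω => ((1 / ((n : ℂ) + 1)))⁻¹ * (F (t₀ + 1 / ((n : ℂ) + 1)) ω - F t₀ ω)) ?_ ?_
    · intro n
      exact ((hm _).sub (hm _)).const_mul _
    · filter_upwards [hd] with ω h
      have h1 := (h t₀).hasDerivAt.tendsto_slope_zero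
      have h2 : Tendsto (fun n : ℕ => 1 / ((n : ℂ) + 1)) atTop (𝓝[≠] 0) := by
        refine tendsto_nhdsWithin_of_tendsto_nhds_of_eventually_within _
          tendsto_one_div_add_atTop_nhds_zero_nat (Eventually.of_forall fun n => ?_)
        have : (n : ℂ) + 1 ≠ 0 := Nat.cast_add_one_ne_zero n
        simpa using this
      simpa [smul_eq_mul, Function.comp_def] using h1.comp h2
  have := hasDerivAt_integral_of_dominated_loc_of_deriv_le (μ := μ) (F := F) (x₀ := t₀)
    (s := Metric.ball t₀ 1) (bound := B) (F' := fun t ω => deriv (fun t => F t ω) t)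
    (Metric.ball_mem_nhds _ one_pos) (Eventually.of_forall hm) hint hmeas ?_ hBi ?_
  · exact this.2.differentiableAt
  · filter_upwards [hB, hd] with ω hω hdω t ht
    have := Complex.norm_deriv_le_of_forall_mem_sphere_norm_le (R := 1) (C := B ω) one_pos
      (f := fun t => F t ω) (c := t) hdω.diffContOnCl ?_
    · simpa using this
    · intro s hs
      apply hω
      have h1 : ‖s - t‖ = 1 := by simpa [dist_eq_norm] using hs
      have h2 : ‖t - t₀‖ < 1 := by simpa [dist_eq_norm] using ht
      calc ‖s‖ = ‖(s - t) + (t - t₀) + t₀‖ := by ring_nf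
        _ ≤ ‖s - t‖ + ‖t - t₀‖ + ‖t₀‖ := norm_add₃_le
        _ ≤ _ := by linarith
  · filter_upwards [hd] with ω h t _ using (h t).hasDerivAt

end Analytic

/-! ### Characteristic functions determine measures on cylinder σ-algebras. -/

section Uniqueness

/-- Finite measures on the σ-algebra generated by a vector space of random variables are determined
by the characteristic functions of these variables. -/
theorem measure_ext_of_charFun_linear {Ω I : Type*} [mΩ : MeasurableSpace Ω] [AddCommGroup I]
    [Module ℝ I] (X : I → Ω → ℝ) (hadd : ∀ i j ω, X (i + j) ω = X i ω + X j ω)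
    (hsmul : ∀ (c : ℝ) i ω, X (c • i) ω = c * X i ω)
    (hmΩ : mΩ = ⨆ i, MeasurableSpace.comap (X i) (borel ℝ))
    (P Q : Measure Ω) [IsFiniteMeasure P] [IsFiniteMeasure Q]
    (h : ∀ i, ∫ ω, Complex.exp (Complex.I * X i ω) ∂P = ∫ ω, Complex.exp (Complex.I * X i ω) ∂Q) :
    P = Q := by
  classical
  have hXm : ∀ i, Measurable (X i) := by
    intro i
    rw [measurable_iff_comap_le, hmΩ, ← BorelSpace.measurable_eq (α := ℝ)]
    exact le_iSup (fun i => MeasurableSpace.comap (X i) _) i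
  let Φ : Ω → I → ℝ := fun ω i => X i ω
  have hΦ : Measurable Φ := measurable_pi_lambda _ hXm
  have hcomap : mΩ = MeasurableSpace.comap Φ MeasurableSpace.pi := by
    rw [hmΩ, MeasurableSpace.pi, MeasurableSpace.comap_iSup]
    refine iSup_congr fun i => ?_
    rw [MeasurableSpace.comap_comp, ← BorelSpace.measurable_eq (α := ℝ)]
    rfl
  have hsum : ∀ (J : Finset I) (c : J → ℝ) ω, X (∑ j, c j • (j : I)) ω = ∑ j, c j * X j ω := by
    intro J c ω
    let l : I →ₗ[ℝ] ℝ := { toFun := fun i => X i ω, map_add' := fun i j => hadd i j ω,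
                           map_smul' := fun c i => hsmul c i ω }
    change l _ = _
    simp [l]
  -- A linear functional of finitely many variables `X j` is again one of the variables `X i`, so
  -- the hypothesis covers the full characteristic function of every finite-dimensional marginal.
  have key : ∀ J : Finset I, (P.map Φ).map J.restrict = (Q.map Φ).map J.restrict := by
    intro J
    have hr : Measurable (J.restrict (π := fun _ : I => ℝ)) := Finset.measurable_restrict J
    apply Measure.ext_of_charFunDual
    ext L
    rw [charFunDual_apply, charFunDual_apply]
    have hLm : StronglyMeasurable fun v : J → ℝ => Complex.exp (L v * Complex.I) := by
      apply Continuous.stronglyMeasurable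
      fun_prop
    rw [Measure.map_map hr hΦ, Measure.map_map hr hΦ,
      integral_map (hr.comp hΦ).aemeasurable hLm.aestronglyMeasurable,
      integral_map (hr.comp hΦ).aemeasurable hLm.aestronglyMeasurable]
    simp only [Function.comp_apply]
    have e : ∀ ω, Complex.exp ((L (J.restrict (Φ ω)) : ℝ) * Complex.I) =
        Complex.exp (Complex.I * X (∑ j : J, L (Pi.single j 1) • (j : I)) ω) := by
      intro ω
      rw [hsum, mul_comm]
      congr 3
      refine (LinearMap.pi_apply_eq_sum_univ (L : (J → ℝ) →ₗ[ℝ] ℝ) (J.restrict (Φ ω))).trans ?_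
      refine Finset.sum_congr rfl fun j _ => ?_
      rw [smul_eq_mul, mul_comm]
      congr 1
      exact congrArg L (funext fun i => by simp [Pi.single_apply, eq_comm])
    simp only [e]
    exact h _
  have hmap : P.map Φ = Q.map Φ := by
    have : ∀ J : Finset I, IsFiniteMeasure ((P.map Φ).map J.restrict) := fun J => inferInstance
    exact IsProjectiveLimit.unique (P := fun J : Finset I => (P.map Φ).map J.restrict)
      (fun J => rfl) (fun J => (key J).symm)
  ext A hA
  rw [hcomap] at hA
  obtain ⟨B, hB, rfl⟩ := hA
  rw [← Measure.map_apply hΦ hB, hmap, Measure.map_apply hΦ hB]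

end Uniqueness

/-! ### Hilbert-Schmidt multilinear forms. -/

section HilbertSchmidt

variable {E : Type*} [NormedAddCommGroup E] [InnerProductSpace ℝ E] {n : ℕ}

theorem sum_le_hsNormSq (f : MultilinearMap ℝ (fun _ : Fin n => E) ℂ) {m : ℕ} {e : Fin m → E}
    (he : Orthonormal ℝ e) :
    ∑ i : Fin n → Fin m, ‖f (fun k => e (i k))‖ₑ ^ 2 ≤ hsNormSq f :=
  le_iSup_of_le m (le_iSup_of_le e (le_iSup_of_le he le_rfl))

theorem sum_fintype_le_hsNormSq (f : MultilinearMap ℝ (fun _ : Fin n => E) ℂ) {κ : Type*}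
    [Fintype κ] [DecidableEq κ] {e : κ → E} (he : Orthonormal ℝ e) :
    ∑ i : Fin n → κ, ‖f (fun k => e (i k))‖ₑ ^ 2 ≤ hsNormSq f := by
  let σ := (Fintype.equivFin κ).symm
  refine le_trans (le_of_eq ?_) (sum_le_hsNormSq f (he.comp σ σ.injective))
  exact (Fintype.sum_equiv (Equiv.arrowCongr (Equiv.refl (Fin n)) σ) _ _ fun i => rfl).symm

theorem sum_real_le_hsNormSq (f : MultilinearMap ℝ (fun _ : Fin n => E) ℂ) (hf : hsNormSq f < ⊤)
    {κ : Type*} [Fintype κ] [DecidableEq κ] {e : κ → E} (he : Orthonormal ℝ e) :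
    ∑ i : Fin n → κ, ‖f (fun k => e (i k))‖ ^ 2 ≤ (hsNormSq f).toReal := by
  have h := ENNReal.toReal_mono hf.ne (sum_fintype_le_hsNormSq f he)
  rw [ENNReal.toReal_sum (by simp)] at h
  simpa using h

/-- A multilinear form is bounded by its Hilbert-Schmidt norm. -/
theorem norm_le_sqrt_hsNormSq_mul (f : MultilinearMap ℝ (fun _ : Fin n => E) ℂ)
    (hf : hsNormSq f < ⊤) (m : Fin n → E) :
    ‖f m‖ ≤ √(hsNormSq f).toReal * ∏ k, ‖m k‖ := by
  classical
  -- Only finitely many vectors occur, so it suffices to expand in an orthonormal basis of their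
  -- span and use Cauchy-Schwarz over multi-indices.
  let W : Submodule ℝ E := Submodule.span ℝ (Set.range m)
  have : FiniteDimensional ℝ W := FiniteDimensional.span_of_finite ℝ (Set.finite_range m)
  let b := stdOrthonormalBasis ℝ W
  let w : Fin n → W := fun k => ⟨m k, Submodule.subset_span ⟨k, rfl⟩⟩
  let e := fun j => (b j : E)
  have he : Orthonormal ℝ e := b.orthonormal.comp_linearIsometry W.subtypeₗᵢ
  have hm : m = fun k => ∑ j, (inner ℝ (b j) (w k)) • e j := by
    funext k
    have := congrArg (fun v : W => (v : E)) (b.sum_repr' (w k))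
    simp only [Submodule.coe_sum, Submodule.coe_smul] at this
    exact this.symm
  have hnorm : ∀ k, ∑ j, (inner ℝ (b j) (w k)) ^ 2 = ‖m k‖ ^ 2 := by
    intro k
    have := b.sum_sq_norm_inner_right (w k)
    simpa using this
  have hexp : f m = ∑ i : Fin n → _, (∏ k, inner ℝ (b (i k)) (w k)) • f (fun k => e (i k)) := by
    conv_lhs => rw [hm]
    rw [f.map_sum]
    refine Finset.sum_congr rfl fun i _ => ?_
    rw [f.map_smul_univ]
  have hprod : ∑ i : Fin n → _, (∏ k, inner ℝ (b (i k)) (w k)) ^ 2 = (∏ k, ‖m k‖) ^ 2 := by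
    simp_rw [← Finset.prod_pow, ← hnorm]
    rw [Finset.prod_univ_sum]
    simp [Fintype.piFinset_univ]
  calc ‖f m‖ ≤ ∑ i : Fin n → _, ‖f (fun k => e (i k))‖ * |∏ k, inner ℝ (b (i k)) (w k)| := by
        rw [hexp]
        refine (norm_sum_le _ _).trans (Finset.sum_le_sum fun i _ => ?_)
        rw [norm_smul, Real.norm_eq_abs, mul_comm]
    _ ≤ √(∑ i : Fin n → _, ‖f (fun k => e (i k))‖ ^ 2) *
        √(∑ i : Fin n → _, |∏ k, inner ℝ (b (i k)) (w k)| ^ 2) :=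
        Real.sum_mul_le_sqrt_mul_sqrt _ _ _
    _ ≤ √(hsNormSq f).toReal * ∏ k, ‖m k‖ := by
        simp_rw [sq_abs]
        rw [hprod, Real.sqrt_sq (Finset.prod_nonneg fun _ _ => norm_nonneg _)]
        gcongr
        exact sum_real_le_hsNormSq f hf he

theorem continuous_of_hsNormSq_lt_top (f : MultilinearMap ℝ (fun _ : Fin n => E) ℂ)
    (hf : hsNormSq f < ⊤) : Continuous f :=
  (f.mkContinuous _ (norm_le_sqrt_hsNormSq_mul f hf)).cont

end HilbertSchmidt

/-! ### The dual space and its cylinder σ-algebra. -/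

section Dual

variable {N : Type*} [AddCommGroup N] [Module ℝ N] [TopologicalSpace N]

theorem TestDual.map_add (x : TestDual N) (ξ η : N) : x (ξ + η) = x ξ + x η :=
  ContinuousLinearMap.map_add (show N →L[ℝ] ℝ from x) ξ η

theorem TestDual.map_smul (x : TestDual N) (c : ℝ) (ξ : N) : x (c • ξ) = c * x ξ :=
  ContinuousLinearMap.map_smul (show N →L[ℝ] ℝ from x) c ξ

theorem TestDual.map_sum_smul (x : TestDual N) {κ : Type*} (s : Finset κ) (c : κ → ℝ) (ξ : κ → N) :
    x (∑ k ∈ s, c k • ξ k) = ∑ k ∈ s, c k * x (ξ k) := by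
  have h : ∀ l : N →L[ℝ] ℝ, l (∑ k ∈ s, c k • ξ k) = ∑ k ∈ s, c k * l (ξ k) := fun l => by simp
  exact h x

theorem TestDual.toComplex_apply (x : TestDual N) (ξ : N) : x.toComplex ξ = (x ξ : ℂ) := rfl

theorem rePart_apply (z : N →L[ℝ] ℂ) (ξ : N) : rePart z ξ = (z ξ).re := rfl

theorem imPart_apply (z : N →L[ℝ] ℂ) (ξ : N) : imPart z ξ = (z ξ).im := rfl

/-- The linear combination `a x + b y` in `N'`. -/
def TestDual.comb (a b : ℝ) (x y : TestDual N) : TestDual N :=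
  (a • (show N →L[ℝ] ℝ from x) + b • (show N →L[ℝ] ℝ from y) : N →L[ℝ] ℝ)

theorem TestDual.comb_apply (a b : ℝ) (x y : TestDual N) (ξ : N) :
    TestDual.comb a b x y ξ = a * x ξ + b * y ξ := rfl

theorem TestDual.toComplex_comb (a b : ℝ) (x y : TestDual N) :
    (TestDual.comb a b x y).toComplex = (a : ℂ) • x.toComplex + (b : ℂ) • y.toComplex := by
  ext ξ
  simp [TestDual.toComplex_apply, TestDual.comb_apply]

theorem toComplex_rePart_add (z : N →L[ℝ] ℂ) :
    (rePart z).toComplex + Complex.I • (imPart z).toComplex = z := by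
  ext ξ
  simp [TestDual.toComplex_apply, rePart_apply, imPart_apply, mul_comm Complex.I]

@[fun_prop]
theorem TestDual.measurable_eval (ξ : N) : Measurable fun x : TestDual N => x ξ := by
  rw [measurable_iff_comap_le]
  exact le_iSup (fun ξ : N => MeasurableSpace.comap (fun x : TestDual N => x ξ) (borel ℝ)) ξ

@[fun_prop]
theorem TestDual.measurable_eval_comp {α : Type*} [MeasurableSpace α] {f : α → TestDual N}
    (hf : Measurable f) (ξ : N) : Measurable fun a => f a ξ :=
  (TestDual.measurable_eval ξ).comp hf

@[fun_prop]
theorem TestDual.measurable_toComplex_eval (ξ : N) :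
    Measurable fun x : TestDual N => x.toComplex ξ :=
  Complex.measurable_ofReal.comp (TestDual.measurable_eval ξ)

theorem TestDual.measurable_of_eval {α : Type*} [MeasurableSpace α] {f : α → TestDual N}
    (hf : ∀ ξ, Measurable fun a => f a ξ) : Measurable f := by
  refine Measurable.of_le_map (iSup_le fun ξ => ?_)
  rw [MeasurableSpace.comap_le_iff_le_map, MeasurableSpace.map_comp,
    ← BorelSpace.measurable_eq (α := ℝ)]
  intro A hA
  exact hf ξ hA

end Dual

/-! ### Adapted bases and the dual norms as ℓ² norms. -/

namespace NuclearTriple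

variable {N : Type*} [AddCommGroup N] [Module ℝ N] [TopologicalSpace N]
  {H : ℕ → Type*} [∀ p, NormedAddCommGroup (H p)] [∀ p, InnerProductSpace ℝ (H p)]
  [∀ p, CompleteSpace (H p)] (S : NuclearTriple N H)

/-- The embedding `N ⊂ H 0 ⊂ N'`. -/
def toDual (η : N) : TestDual N := ((innerSL ℝ (S.emb 0 η)).comp (S.emb 0) : N →L[ℝ] ℝ)

theorem toDual_apply (η ξ : N) : S.toDual η ξ = inner ℝ (S.emb 0 η) (S.emb 0 ξ) := rfl

theorem emb_injective' (p : ℕ) : Function.Injective (S.emb p) := by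
  intro ξ η h
  apply S.emb_injective
  rw [← S.incl_emb p, ← S.incl_emb p, h]

/-- A Hilbert basis of `H p` that consists of elements of `N` and spans a dense subspace of `N`. -/
structure AdaptedBasis (p : ℕ) (ι : Type) where
  /-- the Hilbert basis -/
  basis : HilbertBasis ι ℝ (H p)
  /-- the elements of the basis in `N` -/
  vec : ι → N
  emb_vec : ∀ k, S.emb p (vec k) = basis k
  dense : Dense (Submodule.span ℝ (Set.range vec) : Set N)

/-- Gram-Schmidt in `H p` on a dense sequence of N uses only finite linear combinations, so the
resulting vectors stay in N and have the same span as the sequence. That span is dense in the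
topology of N itself, hence in `H p`. The zero vectors produced by linear dependence are discarded.
-/
theorem exists_adaptedBasis (p : ℕ) :
    ∃ ι : Type, Countable ι ∧ Nonempty (S.AdaptedBasis p ι) := by
  have := S.separable
  let d : ℕ → N := TopologicalSpace.denseSeq N
  have hd : DenseRange d := TopologicalSpace.denseRange_denseSeq N
  let g : ℕ → H p := InnerProductSpace.gramSchmidtNormed ℝ (fun n => S.emb p (d n))
  have hspan : Submodule.span ℝ (Set.range g) =
      (Submodule.span ℝ (Set.range d)).map (S.emb p).toLinearMap := by
    rw [InnerProductSpace.span_gramSchmidtNormed_range, InnerProductSpace.span_gramSchmidt,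
      Submodule.map_span, ← Set.range_comp]
    rfl
  have hlift : ∀ n, ∃ ξ : N, ξ ∈ Submodule.span ℝ (Set.range d) ∧ S.emb p ξ = g n := by
    intro n
    have : g n ∈ Submodule.span ℝ (Set.range g) := Submodule.subset_span ⟨n, rfl⟩
    rw [hspan] at this
    exact this
  choose v hv hvg using hlift
  let ι := {n : ℕ // g n ≠ 0}
  have hon : Orthonormal ℝ (fun k : ι => g k) := InnerProductSpace.gramSchmidtNormed_orthonormal' _
  have hspan' : Submodule.span ℝ (Set.range fun k : ι => g k) = Submodule.span ℝ (Set.range g) := by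
    refine le_antisymm (Submodule.span_mono (by rintro _ ⟨k, rfl⟩; exact ⟨k, rfl⟩))
      (Submodule.span_le.2 ?_)
    rintro _ ⟨n, rfl⟩
    by_cases h : g n = 0
    · rw [h]; exact Submodule.zero_mem _
    · exact Submodule.subset_span ⟨⟨n, h⟩, rfl⟩
  have hdN : Submodule.span ℝ (Set.range fun k : ι => v k) = Submodule.span ℝ (Set.range d) := by
    apply Submodule.map_injective_of_injective (f := (S.emb p).toLinearMap) (S.emb_injective' p)
    rw [← hspan, ← hspan', Submodule.map_span, ← Set.range_comp]
    congr 2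
    funext k
    exact hvg k
  have hdense : Dense (Submodule.span ℝ (Set.range d) : Set N) := hd.mono Submodule.subset_span
  have htop : ⊤ ≤ (Submodule.span ℝ (Set.range fun k : ι => g k)).topologicalClosure := by
    rw [hspan', hspan]
    intro h _
    have h1 : DenseRange (S.emb p) := S.emb_dense p
    have h2 := h1.dense_image (S.emb p).continuous hdense
    exact h2 h
  refine ⟨ι, inferInstance, ⟨⟨HilbertBasis.mk hon htop, fun k => v k, fun k => ?_, ?_⟩⟩⟩
  · simp [hvg]
  · rw [hdN]; exact hdense

namespace AdaptedBasis

variable {S} {p : ℕ} {ι : Type} (B : S.AdaptedBasis p ι)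
include B

theorem norm_emb_sum_sq (s : Finset ι) (c : ι → ℝ) :
    ‖S.emb p (∑ k ∈ s, c k • B.vec k)‖ ^ 2 = ∑ k ∈ s, c k ^ 2 := by
  rw [map_sum, ← real_inner_self_eq_norm_sq]
  simp_rw [map_smul, B.emb_vec]
  rw [B.basis.orthonormal.inner_sum]
  simp [sq]

/-- Cauchy-Schwarz gives the bound on the span of the basis vectors. Both sides are continuous on N,
and the span is dense there. -/
theorem norm_apply_le (z : N →L[ℝ] ℂ) (hz : Summable fun k => ‖z (B.vec k)‖ ^ 2) (ξ : N) :
    ‖z ξ‖ ≤ √(∑' k, ‖z (B.vec k)‖ ^ 2) * ‖S.emb p ξ‖ := by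
  have hclosed : IsClosed {ξ : N | ‖z ξ‖ ≤ √(∑' k, ‖z (B.vec k)‖ ^ 2) * ‖S.emb p ξ‖} :=
    isClosed_le (by fun_prop) (by fun_prop)
  refine hclosed.closure_subset_iff.2 ?_ (B.dense ξ)
  intro ξ hξ
  obtain ⟨c, rfl⟩ := Finsupp.mem_span_range_iff_exists_finsupp.1 hξ
  simp only [Set.mem_ofPred_eq, Finsupp.sum]
  have h1 : ‖S.emb p (∑ k ∈ c.support, c k • B.vec k)‖ = √(∑ k ∈ c.support, c k ^ 2) := by
    rw [← B.norm_emb_sum_sq, Real.sqrt_sq (norm_nonneg _)]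
  rw [h1]
  calc ‖z (∑ k ∈ c.support, c k • B.vec k)‖
      ≤ ∑ k ∈ c.support, ‖z (B.vec k)‖ * |c k| := by
        rw [map_sum]
        refine (norm_sum_le _ _).trans (Finset.sum_le_sum fun k _ => ?_)
        rw [map_smul, norm_smul, Real.norm_eq_abs, mul_comm]
    _ ≤ √(∑ k ∈ c.support, ‖z (B.vec k)‖ ^ 2) * √(∑ k ∈ c.support, |c k| ^ 2) :=
        Real.sum_mul_le_sqrt_mul_sqrt _ _ _
    _ ≤ _ := by
        simp_rw [sq_abs]
        gcongr
        exact hz.sum_le_tsum _ fun _ _ => by positivity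

/-- Replaces a supremum over all of N by a sum over the basis. With a countable index set this makes
the norm measurable, and it identifies H_{-p} with the functionals whose coordinates are in ℓ². -/
theorem dualNorm_eq (x : TestDual N) :
    S.dualNorm p x = (∑' k, ‖x (B.vec k)‖ₑ ^ 2) ^ (1 / 2 : ℝ) := by
  apply le_antisymm
  · by_cases htop : ∑' k, ‖x (B.vec k)‖ₑ ^ 2 = ⊤
    · rw [htop]; simp
    have hsum : Summable fun k => ‖x.toComplex (B.vec k)‖ ^ 2 := by
      have := ENNReal.summable_toReal htop
      simpa [TestDual.toComplex_apply] using this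
    have heq : (∑' k, ‖x (B.vec k)‖ₑ ^ 2) =
        ENNReal.ofReal (∑' k, ‖x.toComplex (B.vec k)‖ ^ 2) := by
      rw [ENNReal.ofReal_tsum_of_nonneg (fun _ => by positivity) hsum]
      refine tsum_congr fun k => ?_
      rw [ENNReal.ofReal_pow (norm_nonneg _), ofReal_norm, TestDual.toComplex_apply]
      congr 1
      simp [enorm_eq_nnnorm]
    rw [heq, ENNReal.ofReal_rpow_of_nonneg (tsum_nonneg fun _ => by positivity) (by norm_num),
      ← Real.sqrt_eq_rpow]
    refine iSup₂_le fun ξ hξ => ?_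
    have h := B.norm_apply_le x.toComplex hsum ξ
    rw [TestDual.toComplex_apply, Complex.norm_real] at h
    rw [← ofReal_norm]
    refine ENNReal.ofReal_le_ofReal (h.trans ?_)
    exact mul_le_of_le_one_right (Real.sqrt_nonneg _) hξ
  · rw [one_div, ENNReal.rpow_inv_le_iff (by norm_num), ENNReal.tsum_eq_iSup_sum]
    refine iSup_le fun s => ?_
    set r := √(∑ k ∈ s, x (B.vec k) ^ 2) with hr
    have hr2 : r ^ 2 = ∑ k ∈ s, x (B.vec k) ^ 2 :=
      Real.sq_sqrt (Finset.sum_nonneg fun _ _ => sq_nonneg _)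
    have hsum : ∑ k ∈ s, ‖x (B.vec k)‖ₑ ^ 2 = ENNReal.ofReal r ^ (2 : ℝ) := by
      rw [ENNReal.rpow_two, ← ENNReal.ofReal_pow (Real.sqrt_nonneg _), hr2,
        ENNReal.ofReal_sum_of_nonneg fun _ _ => sq_nonneg _]
      refine Finset.sum_congr rfl fun k _ => ?_
      rw [← sq_abs, ENNReal.ofReal_pow (abs_nonneg _), ← Real.norm_eq_abs, ofReal_norm]
    rw [hsum]
    gcongr
    rcases (Real.sqrt_nonneg (∑ k ∈ s, x (B.vec k) ^ 2)).eq_or_lt with h0 | h0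
    · rw [hr, ← h0]; simp
    rw [← hr] at h0
    -- The unit vector for which Cauchy-Schwarz on the coordinates in `s` is an equality.
    let ξ : N := ∑ k ∈ s, (x (B.vec k) / r) • B.vec k
    have hξ : ‖S.emb p ξ‖ ≤ 1 := by
      rw [← sq_le_one_iff₀ (norm_nonneg _), B.norm_emb_sum_sq]
      simp_rw [div_pow]
      rw [← Finset.sum_div, ← hr2, div_self (by positivity)]
    have hx : x ξ = r := by
      rw [x.map_sum_smul]
      have : ∀ k, x (B.vec k) / r * x (B.vec k) = x (B.vec k) ^ 2 / r := fun k => by ring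
      simp_rw [this]
      rw [← Finset.sum_div, ← hr2]
      field_simp
    refine le_trans (le_of_eq ?_) (le_iSup₂ (f := fun (ξ : N) (_ : ‖S.emb p ξ‖ ≤ 1) => ‖x ξ‖ₑ) ξ hξ)
    rw [hx, ← ofReal_norm, Real.norm_of_nonneg h0.le]

theorem dualNormC_eq (z : N →L[ℝ] ℂ) :
    S.dualNormC p z = (∑' k, ‖z (B.vec k)‖ₑ ^ 2) ^ (1 / 2 : ℝ) := by
  have h2 : ∀ a : ℝ≥0∞, (a ^ (1 / 2 : ℝ)) ^ 2 = a := fun a => by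
    rw [← ENNReal.rpow_two, ← ENNReal.rpow_mul]; norm_num
  rw [dualNormC, B.dualNorm_eq, B.dualNorm_eq, h2, h2, ← ENNReal.tsum_add]
  congr 2
  funext k
  rw [rePart_apply, imPart_apply, ← ofReal_norm, ← ofReal_norm, ← ofReal_norm,
    ← ENNReal.ofReal_pow (norm_nonneg _), ← ENNReal.ofReal_pow (norm_nonneg _),
    ← ENNReal.ofReal_pow (norm_nonneg _), ← ENNReal.ofReal_add (by positivity) (by positivity)]
  congr 1
  rw [Real.norm_eq_abs, Real.norm_eq_abs, sq_abs, sq_abs, Complex.sq_norm, Complex.normSq_apply]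
  ring

theorem dualNormC_lt_top_iff (z : N →L[ℝ] ℂ) :
    S.dualNormC p z < ⊤ ↔ Summable fun k => ‖z (B.vec k)‖ ^ 2 := by
  rw [B.dualNormC_eq, ENNReal.rpow_lt_top_iff_of_pos (by norm_num)]
  constructor
  · intro h
    simpa using ENNReal.summable_toReal h.ne
  · intro h
    have : ∀ k, ‖z (B.vec k)‖ₑ ^ 2 = ENNReal.ofReal (‖z (B.vec k)‖ ^ 2) := fun k => by
      rw [ENNReal.ofReal_pow (norm_nonneg _), ofReal_norm]
    simp_rw [this]
    exact h.tsum_ofReal_lt_top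

theorem toReal_dualNormC (z : N →L[ℝ] ℂ) :
    (S.dualNormC p z).toReal = √(∑' k, ‖z (B.vec k)‖ ^ 2) := by
  rw [B.dualNormC_eq, ← ENNReal.toReal_rpow, Real.sqrt_eq_rpow, ENNReal.tsum_toReal_eq (by simp)]
  simp


end AdaptedBasis

theorem dualNormC_toComplex (p : ℕ) (x : TestDual N) :
    S.dualNormC p x.toComplex = S.dualNorm p x := by
  obtain ⟨ι, hι, ⟨B⟩⟩ := S.exists_adaptedBasis p
  rw [B.dualNormC_eq, B.dualNorm_eq]
  congr 2
  funext k
  simp [TestDual.toComplex_apply, enorm_eq_nnnorm]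

theorem dualNormC_add_le (p : ℕ) (y z : N →L[ℝ] ℂ) :
    S.dualNormC p (y + z) ≤ S.dualNormC p y + S.dualNormC p z := by
  obtain ⟨ι, hι, ⟨B⟩⟩ := S.exists_adaptedBasis p
  -- With the counting measure on the index set, the dual norm is an L² norm and Minkowski's
  -- inequality applies.
  let : MeasurableSpace ι := ⊤
  have key : ∀ z : N →L[ℝ] ℂ, S.dualNormC p z =
      eLpNorm (fun k => z (B.vec k)) 2 (Measure.count : Measure ι) := by
    intro z
    rw [B.dualNormC_eq, eLpNorm_eq_lintegral_rpow_enorm_toReal (by norm_num) (by norm_num),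
      lintegral_count]
    simp
  rw [key, key, key]
  exact eLpNorm_add_le (Measurable.of_discrete.aestronglyMeasurable)
    (Measurable.of_discrete.aestronglyMeasurable) (by norm_num)

theorem dualNormC_smul (p : ℕ) (c : ℂ) (z : N →L[ℝ] ℂ) :
    S.dualNormC p (c • z) = ‖c‖ₑ * S.dualNormC p z := by
  obtain ⟨ι, hι, ⟨B⟩⟩ := S.exists_adaptedBasis p
  rw [B.dualNormC_eq, B.dualNormC_eq]
  simp only [smul_apply, smul_eq_mul, enorm_mul, mul_pow]
  rw [ENNReal.tsum_mul_left, ENNReal.mul_rpow_of_nonneg _ _ (by norm_num), ← ENNReal.rpow_two,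
    ← ENNReal.rpow_mul]
  norm_num

theorem dualNormC_add_smul_lt_top {p : ℕ} {y z : N →L[ℝ] ℂ} (hy : S.dualNormC p y < ⊤)
    (hz : S.dualNormC p z < ⊤) (t : ℂ) : S.dualNormC p (y + t • z) < ⊤ := by
  refine (S.dualNormC_add_le p _ _).trans_lt (ENNReal.add_lt_top.2 ⟨hy, ?_⟩)
  rw [dualNormC_smul]
  exact ENNReal.mul_lt_top (by simp) hz

theorem toReal_dualNormC_add_smul_le {p : ℕ} {y z : N →L[ℝ] ℂ} (hy : S.dualNormC p y < ⊤)
    (hz : S.dualNormC p z < ⊤) (t : ℂ) :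
    (S.dualNormC p (y + t • z)).toReal ≤
      (S.dualNormC p y).toReal + ‖t‖ * (S.dualNormC p z).toReal := by
  have hz' : ‖t‖ₑ * S.dualNormC p z < ⊤ := ENNReal.mul_lt_top (by simp) hz
  have h := ENNReal.toReal_mono (ENNReal.add_lt_top.2 ⟨hy, hz'⟩).ne
    ((S.dualNormC_add_le p y (t • z)).trans_eq (by rw [dualNormC_smul]))
  rwa [ENNReal.toReal_add hy.ne hz'.ne, ENNReal.toReal_mul, toReal_enorm] at h

theorem norm_apply_le {p : ℕ} {z : N →L[ℝ] ℂ} (hz : S.dualNormC p z < ⊤) (ξ : N) :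
    ‖z ξ‖ ≤ (S.dualNormC p z).toReal * ‖S.emb p ξ‖ := by
  obtain ⟨ι, hι, ⟨B⟩⟩ := S.exists_adaptedBasis p
  rw [B.toReal_dualNormC]
  exact B.norm_apply_le z ((B.dualNormC_lt_top_iff z).1 hz) ξ

theorem measurable_dualNorm (p : ℕ) : Measurable (S.dualNorm p) := by
  obtain ⟨ι, hι, ⟨B⟩⟩ := S.exists_adaptedBasis p
  have : S.dualNorm p = fun x => (∑' k, ‖x (B.vec k)‖ₑ ^ 2) ^ (1 / 2 : ℝ) :=
    funext B.dualNorm_eq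
  rw [this]
  exact (Measurable.tsum fun k =>
    ((TestDual.measurable_eval (B.vec k)).enorm.pow_const 2)).pow_const _

/-- The embedding `N ⊂ N'` takes its values in all the `H_{-p}`. -/
theorem dualNorm_toDual_lt_top (p : ℕ) (η : N) : S.dualNorm p (S.toDual η) < ⊤ := by
  refine lt_of_le_of_lt (b := ENNReal.ofReal ‖S.emb 0 η‖) (iSup₂_le fun ξ hξ => ?_) (by simp)
  rw [← ofReal_norm, toDual_apply]
  refine ENNReal.ofReal_le_ofReal ((norm_inner_le_norm _ _).trans ?_)
  refine mul_le_of_le_one_right (norm_nonneg _) ?_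
  rw [← S.incl_emb p]
  exact (S.norm_incl_le p _).trans hξ

end NuclearTriple

namespace NuclearTriple

variable {N : Type*} [AddCommGroup N] [Module ℝ N] [TopologicalSpace N]
  {H : ℕ → Type*} [∀ p, NormedAddCommGroup (H p)] [∀ p, InnerProductSpace ℝ (H p)]
  [∀ p, CompleteSpace (H p)] {S : NuclearTriple N H}

/-! ### One-dimensional marginals. -/

section Law

variable {μ : Measure (TestDual N)} (hμ : S.IsCanonicalGaussian μ)
include hμ

theorem IsCanonicalGaussian.map_eval (ξ : N) :
    μ.map (fun x => x ξ) = ProbabilityTheory.gaussianReal 0 (‖S.emb 0 ξ‖ ^ 2).toNNReal := by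
  have := hμ.1
  have hm := TestDual.measurable_eval ξ
  have : IsProbabilityMeasure (μ.map (fun x => x ξ)) :=
    Measure.isProbabilityMeasure_map hm.aemeasurable
  apply Measure.ext_of_charFun
  ext t
  rw [charFun_apply_real, ProbabilityTheory.charFun_gaussianReal, integral_map hm.aemeasurable
    (by fun_prop)]
  have h := hμ.2 (t • ξ)
  simp_rw [TestDual.map_smul] at h
  convert h using 1
  · congr 1
    ext x
    push_cast
    ring_nf
  · rw [map_smul, norm_smul, Complex.ofReal_exp]
    congr 1
    rw [Real.coe_toNNReal _ (by positivity), mul_pow, Real.norm_eq_abs, sq_abs]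
    push_cast
    ring

theorem IsCanonicalGaussian.integrable_exp_mul (ξ : N) (t : ℝ) :
    Integrable (fun x : TestDual N => Real.exp (t * x ξ)) μ := by
  have h : Integrable (fun x : ℝ => Real.exp (t * x)) (μ.map fun x => x ξ) := by
    rw [hμ.map_eval]
    exact ProbabilityTheory.integrable_exp_mul_gaussianReal t
  exact h.comp_measurable (TestDual.measurable_eval ξ)

theorem IsCanonicalGaussian.integrable_exp_abs_mul (ξ : N) (t : ℝ) :
    Integrable (fun x : TestDual N => Real.exp (t * |x ξ|)) μ := by
  refine ((hμ.integrable_exp_mul ξ t).add (hμ.integrable_exp_mul ξ (-t))).mono' ?_ ?_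
  · have := TestDual.measurable_eval ξ
    exact (by fun_prop : Measurable fun x : TestDual N => Real.exp (t * |x ξ|)).aestronglyMeasurable
  · refine Eventually.of_forall fun x => ?_
    rw [Real.norm_of_nonneg (Real.exp_pos _).le, Pi.add_apply]
    rcases abs_cases (x ξ) with ⟨h, _⟩ | ⟨h, _⟩ <;> rw [h]
    · exact le_add_of_nonneg_right (Real.exp_pos _).le
    · rw [mul_neg, ← neg_mul]
      exact le_add_of_nonneg_left (Real.exp_pos _).le

end Law

/-! ### Gaussian tail of the dual norm. -/

section Fernique

variable {μ : Measure (TestDual N)} (hμ : S.IsCanonicalGaussian μ) {p : ℕ}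

include hμ in
/-- Exponential integrability of finite sums of squared coordinates, by convexity of `exp`. -/
theorem lintegral_exp_sum_sq_le {ι : Type} (B : S.AdaptedBasis p ι)
    (hp : IsHilbertSchmidt (S.incl p)) :
    ∃ δ > 0, ∃ K < (⊤ : ℝ≥0∞), ∀ s : Finset ι,
      ∫⁻ x, ENNReal.ofReal (Real.exp (δ * ∑ k ∈ s, x (B.vec k) ^ 2)) ∂μ ≤ K := by
  classical
  have := hμ.1
  obtain ⟨T, hT⟩ := hp
  let γ := ProbabilityTheory.gaussianReal 0 1
  obtain ⟨c, hc, hint⟩ := ProbabilityTheory.IsGaussian.exists_integrable_exp_sq γ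
  let a : ι → ℝ := fun k => ‖S.emb 0 (B.vec k)‖
  have ha : ∀ k, 0 < a k := fun k => by
    refine norm_pos_iff.2 fun h0 => ?_
    have h1 : B.vec k = 0 := S.emb_injective (by rw [h0, map_zero])
    have h2 := B.basis.orthonormal.1 k
    rw [← B.emb_vec, h1, map_zero, norm_zero] at h2
    exact zero_ne_one h2
  have hsum : ∀ s : Finset ι, ∑ k ∈ s, a k ^ 2 ≤ |T| + 1 := by
    intro s
    let σ := s.equivFin.symm
    have h1 := hT s.card (fun j => B.basis (σ j))
      (B.basis.orthonormal.comp (fun j => (σ j : ι)) (Subtype.val_injective.comp σ.injective))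
    have h2 : ∑ k ∈ s, a k ^ 2 = ∑ j, ‖S.incl p (B.basis (σ j))‖ ^ 2 := by
      rw [← Finset.sum_coe_sort s, ← Equiv.sum_comp σ]
      refine Finset.sum_congr rfl fun j _ => ?_
      rw [← B.emb_vec, S.incl_emb]
    rw [h2]
    linarith [le_abs_self T]
  have hTpos : 0 < |T| + 1 := by positivity
  let K : ℝ≥0∞ := ∫⁻ y, ENNReal.ofReal (Real.exp (c * ‖y‖ ^ 2)) ∂γ
  have hK : K < ⊤ := by
    have := hint.2
    rw [hasFiniteIntegral_iff_ofReal (Eventually.of_forall fun _ => (Real.exp_pos _).le)] at this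
    exact this
  have hK1 : 1 ≤ K := by
    calc (1 : ℝ≥0∞) = ∫⁻ y, 1 ∂γ := by simp
      _ ≤ K := lintegral_mono fun y => by
        rw [← ENNReal.ofReal_one]
        exact ENNReal.ofReal_le_ofReal (Real.one_le_exp (by positivity))
  have hlaw : ∀ k, ∫⁻ x, ENNReal.ofReal (Real.exp (c * (x (B.vec k) / a k) ^ 2)) ∂μ = K := by
    intro k
    have hmap : μ.map (fun x => x (B.vec k) / a k) = γ := by
      have h1 : (μ.map fun x => x (B.vec k)).map (fun y => y / a k) = γ := by
        rw [hμ.map_eval, ProbabilityTheory.gaussianReal_map_div_const, zero_div]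
        congr 1
        ext
        push_cast
        rw [Real.coe_toNNReal _ (by positivity)]
        exact div_self (pow_pos (ha k) 2).ne'
      rwa [Measure.map_map (by fun_prop) (TestDual.measurable_eval _)] at h1
    have hm := TestDual.measurable_eval (B.vec k)
    change _ = ∫⁻ y, ENNReal.ofReal (Real.exp (c * ‖y‖ ^ 2)) ∂γ
    rw [← hmap, lintegral_map (by fun_prop) (by fun_prop)]
    simp only [Real.norm_eq_abs, sq_abs]
  -- `c` works for one standard Gaussian, and |T| + 1 > 0 bounds every partial sum of the variances
  -- `a k ^ 2`, by the Hilbert-Schmidt hypothesis. The resulting δ is thus independent of `s`.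
  refine ⟨c / (|T| + 1), by positivity, K, hK, fun s => ?_⟩
  rcases s.eq_empty_or_nonempty with rfl | hs
  · simpa using hK1
  set Ts := ∑ k ∈ s, a k ^ 2 with hTs
  have hTs0 : 0 < Ts := Finset.sum_pos (fun k _ => pow_pos (ha k) 2) hs
  -- With variances as weights, the sum of x(v_k)² is `Ts` times a convex combination of squares of
  -- standard Gaussians. Jensen then bounds the integral by `K`; no independence of the coordinates
  -- is needed.
  let w : ι → ℝ := fun k => a k ^ 2 / Ts
  have hw0 : ∀ k, 0 ≤ w k := fun k => by positivity
  have hw1 : ∑ k ∈ s, w k = 1 := by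
    rw [← Finset.sum_div, div_self hTs0.ne']
  have hbound : ∀ x : TestDual N, Real.exp (c / (|T| + 1) * ∑ k ∈ s, x (B.vec k) ^ 2) ≤
      ∑ k ∈ s, w k * Real.exp (c * (x (B.vec k) / a k) ^ 2) := by
    intro x
    have h1 := convexOn_exp.map_sum_le (t := s) (w := w)
      (p := fun k => c * (x (B.vec k) / a k) ^ 2) (fun k _ => hw0 k) hw1 (fun _ _ => trivial)
    simp only [smul_eq_mul] at h1
    refine le_trans (Real.exp_le_exp.2 ?_) h1
    have h2 : ∀ k, w k * (c * (x (B.vec k) / a k) ^ 2) = c / Ts * x (B.vec k) ^ 2 := by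
      intro k
      have := (ha k).ne'
      simp only [w]
      field_simp
    simp_rw [h2]
    rw [← Finset.mul_sum]
    gcongr
    exact hsum s
  calc ∫⁻ x, ENNReal.ofReal (Real.exp (c / (|T| + 1) * ∑ k ∈ s, x (B.vec k) ^ 2)) ∂μ
      ≤ ∫⁻ x, ∑ k ∈ s, ENNReal.ofReal (w k) *
          ENNReal.ofReal (Real.exp (c * (x (B.vec k) / a k) ^ 2)) ∂μ := by
        refine lintegral_mono fun x => (ENNReal.ofReal_le_ofReal (hbound x)).trans_eq ?_
        rw [ENNReal.ofReal_sum_of_nonneg fun k _ => mul_nonneg (hw0 k) (Real.exp_pos _).le]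
        exact Finset.sum_congr rfl fun k _ => ENNReal.ofReal_mul (hw0 k)
    _ = ∑ k ∈ s, ENNReal.ofReal (w k) * K := by
        have hm := fun k => TestDual.measurable_eval (B.vec k)
        rw [lintegral_finsetSum _ fun k _ => by have := hm k; fun_prop]
        refine Finset.sum_congr rfl fun k _ => ?_
        rw [lintegral_const_mul _ (by have := hm k; fun_prop), hlaw]
    _ = K := by
        rw [← Finset.sum_mul, ← ENNReal.ofReal_sum_of_nonneg fun k _ => hw0 k, hw1]
        simp

include hμ in
/-- `H_{-p}` has full measure, and the norm `|x|_{-p}` has a Gaussian tail. -/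
theorem ae_dualNorm_lt_top_and_exists_integrable_exp_sq (hp : IsHilbertSchmidt (S.incl p)) :
    (∀ᵐ x ∂μ, S.dualNorm p x < ⊤) ∧
      ∃ δ > 0, Integrable (fun x => Real.exp (δ * (S.dualNorm p x).toReal ^ 2)) μ := by
  classical
  obtain ⟨ι, hι, ⟨B⟩⟩ := S.exists_adaptedBasis p
  obtain ⟨δ, hδ, K, hK, hbound⟩ := lintegral_exp_sum_sq_le hμ B hp
  let M : TestDual N → ℝ≥0∞ := fun x =>
    ⨆ s : Finset ι, ENNReal.ofReal (Real.exp (δ * ∑ k ∈ s, x (B.vec k) ^ 2))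
  have hMm : ∀ s : Finset ι, Measurable fun x : TestDual N =>
      ENNReal.ofReal (Real.exp (δ * ∑ k ∈ s, x (B.vec k) ^ 2)) := by
    intro s
    have hm := fun k => TestDual.measurable_eval (B.vec k)
    fun_prop
  have hM : ∫⁻ x, M x ∂μ ≤ K := by
    -- Monotone convergence over the finite subsets, a countable directed family since ι is
    -- countable.
    rw [lintegral_iSup_directed (fun s => (hMm s).aemeasurable)]
    · exact iSup_le hbound
    · refine Monotone.directed_le fun s t hst x => ?_
      refine ENNReal.ofReal_le_ofReal (Real.exp_le_exp.2 (mul_le_mul_of_nonneg_left ?_ hδ.le))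
      exact Finset.sum_le_sum_of_subset_of_nonneg hst fun _ _ _ => sq_nonneg _
  have hMmeas : Measurable M := Measurable.iSup hMm
  have hMae : ∀ᵐ x ∂μ, M x < ⊤ := ae_lt_top hMmeas (hM.trans_lt hK).ne
  have key : ∀ x, M x < ⊤ → S.dualNorm p x < ⊤ ∧
      ENNReal.ofReal (Real.exp (δ * (S.dualNorm p x).toReal ^ 2)) ≤ M x := by
    intro x hx
    have h1 : ∀ s : Finset ι, Real.exp (δ * ∑ k ∈ s, x (B.vec k) ^ 2) ≤ (M x).toReal := fun s =>
      (ENNReal.ofReal_le_iff_le_toReal hx.ne).1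
        (le_iSup (fun s : Finset ι => ENNReal.ofReal (Real.exp (δ * ∑ k ∈ s, x (B.vec k) ^ 2))) s)
    have hpos : 0 < (M x).toReal := (Real.exp_pos _).trans_le (h1 ∅)
    have h2 : ∀ s : Finset ι, ∑ k ∈ s, x (B.vec k) ^ 2 ≤ Real.log (M x).toReal / δ := by
      intro s
      rw [le_div_iff₀ hδ, mul_comm, Real.le_log_iff_exp_le hpos]
      exact h1 s
    have hsq : ∀ k, ‖x.toComplex (B.vec k)‖ ^ 2 = x (B.vec k) ^ 2 := fun k => by
      rw [TestDual.toComplex_apply, Complex.norm_real, Real.norm_eq_abs, sq_abs]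
    have hs : Summable fun k => ‖x.toComplex (B.vec k)‖ ^ 2 := by
      simp_rw [hsq]
      exact summable_of_sum_le (fun _ => sq_nonneg _) h2
    rw [← dualNormC_toComplex]
    refine ⟨(B.dualNormC_lt_top_iff _).2 hs, ?_⟩
    rw [B.toReal_dualNormC, Real.sq_sqrt (tsum_nonneg fun _ => by positivity),
      ENNReal.ofReal_le_iff_le_toReal hx.ne, ← Real.le_log_iff_exp_le hpos, mul_comm,
      ← le_div_iff₀ hδ]
    simp_rw [hsq] at hs ⊢
    exact hs.tsum_le_of_sum_le h2
  refine ⟨hMae.mono fun x hx => (key x hx).1, δ, hδ, ?_, ?_⟩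
  · have := S.measurable_dualNorm p
    exact (by fun_prop : Measurable fun x =>
      Real.exp (δ * (S.dualNorm p x).toReal ^ 2)).aestronglyMeasurable
  · rw [hasFiniteIntegral_iff_ofReal (Eventually.of_forall fun _ => (Real.exp_pos _).le)]
    refine lt_of_le_of_lt (lintegral_mono_ae ?_) (hM.trans_lt hK)
    exact hMae.mono fun x hx => (key x hx).2

include hμ in
theorem IsCanonicalGaussian.ae_dualNorm_lt_top (hp : IsHilbertSchmidt (S.incl p)) :
    ∀ᵐ x ∂μ, S.dualNorm p x < ⊤ :=
  (ae_dualNorm_lt_top_and_exists_integrable_exp_sq hμ hp).1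

include hμ in
theorem IsCanonicalGaussian.integrable_exp_dualNorm (hp : IsHilbertSchmidt (S.incl p)) (ε : ℝ) :
    Integrable (fun x => Real.exp (ε * (S.dualNorm p x).toReal)) μ := by
  obtain ⟨-, δ, hδ, hint⟩ := ae_dualNorm_lt_top_and_exists_integrable_exp_sq hμ hp
  refine (hint.const_mul (Real.exp (ε ^ 2 / (4 * δ)))).mono' ?_ (Eventually.of_forall fun x => ?_)
  · have := S.measurable_dualNorm p
    exact (by fun_prop : Measurable fun x =>
      Real.exp (ε * (S.dualNorm p x).toReal)).aestronglyMeasurable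
  · rw [Real.norm_of_nonneg (Real.exp_pos _).le, ← Real.exp_add, Real.exp_le_exp]
    generalize (S.dualNorm p x).toReal = r
    -- Completing the square shows that εr ≤ ε²/(4δ) + δr².
    have : ε ^ 2 / (4 * δ) + δ * r ^ 2 - ε * r = (ε - 2 * δ * r) ^ 2 / (4 * δ) := by
      field_simp
      ring
    have h2 : 0 ≤ (ε - 2 * δ * r) ^ 2 / (4 * δ) := by positivity
    linarith

include hμ in
theorem IsCanonicalGaussian.expConst_eq (hp : IsHilbertSchmidt (S.incl p)) (ε : ℝ) :
    S.expConst μ p ε = ENNReal.ofReal (∫ x, Real.exp (ε * (S.dualNorm p x).toReal) ∂μ) := by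
  rw [ofReal_integral_eq_lintegral_ofReal (hμ.integrable_exp_dualNorm hp ε)
    (Eventually.of_forall fun _ => (Real.exp_pos _).le), expConst]
  refine lintegral_congr_ae ?_
  filter_upwards [hμ.ae_dualNorm_lt_top hp] with x hx
  lift S.dualNorm p x to NNReal using hx.ne with r
  rw [ENNReal.coe_toReal, ← EReal.exp_coe, EReal.coe_mul]
  rfl

end Fernique

end NuclearTriple

namespace NuclearTriple

variable {N : Type*} [AddCommGroup N] [Module ℝ N] [TopologicalSpace N]
  {H : ℕ → Type*} [∀ p, NormedAddCommGroup (H p)] [∀ p, InnerProductSpace ℝ (H p)]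
  [∀ p, CompleteSpace (H p)] (S : NuclearTriple N H)

theorem measurable_shift (η : N) : Measurable fun x => TestDual.comb 1 1 x (S.toDual η) := by
  refine TestDual.measurable_of_eval fun ξ => ?_
  simp_rw [TestDual.comb_apply]
  fun_prop

variable {S} {μ : Measure (TestDual N)} (hμ : S.IsCanonicalGaussian μ)
include hμ

/-! ### Translations of the Gaussian measure. -/

section CameronMartin

theorem IsCanonicalGaussian.integral_exp_add_mul (ξ η : N) (t : ℂ) :
    ∫ x, Complex.exp (Complex.I * x ξ + t * x η) ∂μ =
      Complex.exp (-(1 / 2) * ‖S.emb 0 ξ‖ ^ 2 + Complex.I * t * inner ℝ (S.emb 0 ξ) (S.emb 0 η) +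
        1 / 2 * t ^ 2 * ‖S.emb 0 η‖ ^ 2) := by
  have := hμ.1
  have h1 : Differentiable ℂ fun t : ℂ =>
      ∫ x, Complex.exp (Complex.I * x ξ + t * x η) ∂μ := by
    apply differentiable_integral_of_dominated
    · intro t
      exact (by fun_prop : Measurable fun x : TestDual N =>
        Complex.exp (Complex.I * x ξ + t * x η)).aestronglyMeasurable
    · exact Eventually.of_forall fun x => by fun_prop
    · intro R
      refine ⟨_, hμ.integrable_exp_abs_mul η R, Eventually.of_forall fun x t ht => ?_⟩
      rw [Complex.norm_exp]
      apply Real.exp_le_exp.2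
      have : (Complex.I * x ξ + t * x η).re = t.re * x η := by simp
      rw [this]
      calc t.re * x η ≤ |t.re| * |x η| := by rw [← abs_mul]; exact le_abs_self _
        _ ≤ R * |x η| := by gcongr; exact (Complex.abs_re_le_norm t).trans ht
  have h2 : Differentiable ℂ fun t : ℂ =>
      Complex.exp (-(1 / 2) * ‖S.emb 0 ξ‖ ^ 2 + Complex.I * t * inner ℝ (S.emb 0 ξ) (S.emb 0 η) +
        1 / 2 * t ^ 2 * ‖S.emb 0 η‖ ^ 2) := by fun_prop
  -- At t = is the identity is the characteristic function of μ at ξ + sη, and both sides are entire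
  -- in t.
  refine congrFun (entire_eq_of_eq_on_line h1 h2 Complex.I_ne_zero fun s => ?_) t
  have h := hμ.2 (ξ + s • η)
  simp_rw [TestDual.map_add, TestDual.map_smul] at h
  convert h using 1
  · congr 1
    ext x
    push_cast
    ring_nf
  · rw [map_add, map_smul, @norm_add_sq_real, norm_smul, inner_smul_right, Complex.ofReal_exp]
    congr 1
    rw [mul_pow ‖s‖, Real.norm_eq_abs, sq_abs]
    push_cast
    have hI : Complex.I ^ 2 = -1 := Complex.I_sq
    linear_combination ((s : ℂ) * inner ℝ (S.emb 0 ξ) (S.emb 0 η) +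
      1 / 2 * (s : ℂ) ^ 2 * ‖S.emb 0 η‖ ^ 2) * hI

/-- The Cameron-Martin theorem. -/
theorem IsCanonicalGaussian.map_shift (η : N) :
    μ.map (fun x => TestDual.comb 1 1 x (S.toDual η)) =
      μ.withDensity fun x => ENNReal.ofReal (Real.exp (x η - 1 / 2 * ‖S.emb 0 η‖ ^ 2)) := by
  have := hμ.1
  have hm := S.measurable_shift η
  have : IsProbabilityMeasure (μ.map fun x => TestDual.comb 1 1 x (S.toDual η)) :=
    Measure.isProbabilityMeasure_map hm.aemeasurable
  have hint : Integrable (fun x : TestDual N => Real.exp (x η - 1 / 2 * ‖S.emb 0 η‖ ^ 2)) μ := by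
    simp_rw [Real.exp_sub, div_eq_mul_inv]
    simpa using (hμ.integrable_exp_mul η 1).mul_const _
  have : IsFiniteMeasure (μ.withDensity fun x =>
      ENNReal.ofReal (Real.exp (x η - 1 / 2 * ‖S.emb 0 η‖ ^ 2))) :=
    isFiniteMeasure_withDensity_ofReal hint.2
  refine measure_ext_of_charFun_linear (I := N) (fun ξ (x : TestDual N) => x ξ) (fun ξ ζ x => x.map_add ξ ζ)
    (fun c ξ x => x.map_smul c ξ) rfl _ _ fun ξ => ?_
  rw [integral_map hm.aemeasurable (by
      exact (by fun_prop : Measurable fun x : TestDual N =>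
        Complex.exp (Complex.I * x ξ)).aestronglyMeasurable),
    integral_withDensity_eq_integral_toReal_smul (by fun_prop) (by simp)]
  have h1 : ∀ x : TestDual N, (ENNReal.ofReal (Real.exp (x η - 1 / 2 * ‖S.emb 0 η‖ ^ 2))).toReal •
      Complex.exp (Complex.I * x ξ) =
      Complex.exp (Complex.I * x ξ + 1 * x η) * Complex.exp (-(1 / 2 * ‖S.emb 0 η‖ ^ 2)) := by
    intro x
    rw [ENNReal.toReal_ofReal (Real.exp_pos _).le, Complex.real_smul, Complex.ofReal_exp,
      ← Complex.exp_add, ← Complex.exp_add]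
    push_cast
    ring_nf
  have h2 : ∀ x : TestDual N, Complex.exp (Complex.I * (TestDual.comb 1 1 x (S.toDual η) ξ : ℝ)) =
      Complex.exp (Complex.I * x ξ) *
        Complex.exp (Complex.I * inner ℝ (S.emb 0 ξ) (S.emb 0 η)) := by
    intro x
    rw [TestDual.comb_apply, toDual_apply, ← Complex.exp_add, real_inner_comm]
    push_cast
    ring_nf
  simp_rw [h1, h2]
  rw [integral_mul_const, integral_mul_const, hμ.integral_exp_add_mul, hμ.2, Complex.ofReal_exp,
    ← Complex.exp_add, ← Complex.exp_add]
  push_cast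
  ring_nf

theorem IsCanonicalGaussian.map_shift_absolutelyContinuous (η : N) :
    μ.map (fun x => TestDual.comb 1 1 x (S.toDual η)) ≪ μ := by
  rw [hμ.map_shift]
  exact withDensity_absolutelyContinuous _ _

/-- By Cameron-Martin, the S-transform of a function at η is the mean of its translate by η. -/
theorem IsCanonicalGaussian.integral_mul_exp (η : N) {F : TestDual N → ℂ}
    (hF : AEStronglyMeasurable F μ) :
    ∫ x, F x * Real.exp (x η - 1 / 2 * ‖S.emb 0 η‖ ^ 2) ∂μ =
      ∫ x, F (TestDual.comb 1 1 x (S.toDual η)) ∂μ := by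
  rw [← integral_map (φ := fun x => TestDual.comb 1 1 x (S.toDual η)) (f := F)
    (S.measurable_shift η).aemeasurable (hF.mono_ac (hμ.map_shift_absolutelyContinuous η)),
    hμ.map_shift, integral_withDensity_eq_integral_toReal_smul (by fun_prop) (by simp)]
  refine integral_congr_ae (Eventually.of_forall fun x => ?_)
  simp only
  rw [ENNReal.toReal_ofReal (Real.exp_pos _).le, Complex.real_smul, mul_comm]

end CameronMartin

/-! ### Exponentials are total in L²(μ). -/

section Totality

theorem IsCanonicalGaussian.memLp_exp_abs_mul (η : N) (t : ℝ) :
    MemLp (fun x : TestDual N => Real.exp (t * |x η|)) 2 μ := by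
  rw [memLp_two_iff_integrable_sq (by
    exact (by fun_prop : Measurable fun x : TestDual N =>
      Real.exp (t * |x η|)).aestronglyMeasurable)]
  convert hμ.integrable_exp_abs_mul η (2 * t) using 2 with x
  rw [← Real.exp_nat_mul]
  push_cast
  ring_nf

theorem IsCanonicalGaussian.memLp_exp_mul (η : N) (c : ℝ) :
    MemLp (fun x : TestDual N => (Real.exp (x η - c) : ℂ)) 2 μ := by
  refine ((hμ.memLp_exp_abs_mul η 1).const_mul (Real.exp (-c))).of_le ?_
    (Eventually.of_forall fun x => ?_)
  · exact (by fun_prop : Measurable fun x : TestDual N =>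
      (Real.exp (x η - c) : ℂ)).aestronglyMeasurable
  · rw [Complex.norm_real, ← Real.exp_add, Real.norm_of_nonneg (Real.exp_pos _).le,
      Real.norm_of_nonneg (Real.exp_pos _).le, Real.exp_le_exp]
    linarith [le_abs_self (x η)]

/-- Totality of the exponentials in the real `L²(μ)`. -/
theorem IsCanonicalGaussian.ae_eq_zero_of_integral_mul_exp_real {a : TestDual N → ℝ}
    (ha : MemLp a 2 μ) (h : ∀ η : N, ∫ x, a x * Real.exp (x η) ∂μ = 0) : a =ᵐ[μ] 0 := by
  have := hμ.1
  have hai : Integrable a μ := ha.integrable (by norm_num)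
  -- The pairing with e^{t⟨x,ξ⟩} is entire in t and vanishes for real t, by the hypothesis at tξ;
  -- hence it vanishes at t = i.
  have hchar : ∀ ξ : N, ∫ x, (a x : ℂ) * Complex.exp (Complex.I * x ξ) ∂μ = 0 := by
    intro ξ
    have h1 : Differentiable ℂ fun t : ℂ => ∫ x, (a x : ℂ) * Complex.exp (t * x ξ) ∂μ := by
      apply differentiable_integral_of_dominated
      · intro t
        exact (Complex.continuous_ofReal.comp_aestronglyMeasurable ha.1).mul
          (by fun_prop : Measurable fun x : TestDual N =>
            Complex.exp (t * x ξ)).aestronglyMeasurable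
      · exact Eventually.of_forall fun x => by fun_prop
      · intro R
        refine ⟨_, ha.norm.integrable_mul (hμ.memLp_exp_abs_mul ξ R),
          Eventually.of_forall fun x t ht => ?_⟩
        rw [norm_mul, Complex.norm_real, Complex.norm_exp]
        simp only [Pi.mul_apply]
        gcongr
        have : (t * x ξ).re = t.re * x ξ := by simp
        rw [this]
        calc t.re * x ξ ≤ |t.re| * |x ξ| := by rw [← abs_mul]; exact le_abs_self _
          _ ≤ R * |x ξ| := by gcongr; exact (Complex.abs_re_le_norm t).trans ht
    have h2 := congrFun (entire_eq_of_eq_on_line h1 (differentiable_const (0 : ℂ)) one_ne_zero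
      fun s => ?_) Complex.I
    · exact h2
    · have h3 := h (s • ξ)
      simp_rw [TestDual.map_smul] at h3
      have h4 := congrArg (fun r : ℝ => (r : ℂ)) h3
      simp only [Complex.ofReal_zero] at h4
      rw [← integral_complex_ofReal] at h4
      simpa using h4
  have hfin1 : IsFiniteMeasure (μ.withDensity fun x => ENNReal.ofReal (a x)) :=
    isFiniteMeasure_withDensity_ofReal hai.2
  have hfin2 : IsFiniteMeasure (μ.withDensity fun x => ENNReal.ofReal (-a x)) :=
    isFiniteMeasure_withDensity_ofReal hai.neg.2
  -- The positive and negative parts of `a` are densities of two finite measures with the same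
  -- characteristic function, so they agree almost everywhere. As they have disjoint supports, both
  -- vanish.
  have heq : (μ.withDensity fun x => ENNReal.ofReal (a x)) =
      μ.withDensity fun x => ENNReal.ofReal (-a x) := by
    refine measure_ext_of_charFun_linear (I := N) (fun ξ (x : TestDual N) => x ξ) (fun ξ ζ x => x.map_add ξ ζ)
      (fun c ξ x => x.map_smul c ξ) rfl _ _ fun ξ => ?_
    have hb : AEStronglyMeasurable (fun x : TestDual N => Complex.exp (Complex.I * x ξ)) μ :=
      (by fun_prop : Measurable fun x : TestDual N =>
        Complex.exp (Complex.I * x ξ)).aestronglyMeasurable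
    have hbn : ∀ x : TestDual N, ‖Complex.exp (Complex.I * x ξ)‖ ≤ 1 := fun x => by
      rw [Complex.norm_exp]; simp
    have hneg : AEMeasurable (fun x => ENNReal.ofReal (-a x)) μ :=
      ha.1.aemeasurable.neg.ennreal_ofReal
    rw [integral_withDensity_eq_integral_toReal_smul₀ ha.1.aemeasurable.ennreal_ofReal (by simp),
      integral_withDensity_eq_integral_toReal_smul₀ hneg (by simp),
      ← sub_eq_zero, ← integral_sub, ← hchar ξ]
    · refine integral_congr_ae (Eventually.of_forall fun x => ?_)
      simp only
      rw [← sub_smul, Complex.real_smul]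
      congr 2
      rw [ENNReal.toReal_ofReal', ENNReal.toReal_ofReal', max_zero_sub_eq_self]
    · exact (Integrable.bdd_mul (c := 1) hai.pos_part.ofReal hb
        (Eventually.of_forall hbn)).congr (Eventually.of_forall fun x => by
          simp [ENNReal.toReal_ofReal', mul_comm])
    · exact (Integrable.bdd_mul (c := 1) hai.neg_part.ofReal hb
        (Eventually.of_forall hbn)).congr (Eventually.of_forall fun x => by
          simp [ENNReal.toReal_ofReal', mul_comm])
  have h5 := (withDensity_eq_iff ha.1.aemeasurable.ennreal_ofReal
    ha.1.aemeasurable.neg.ennreal_ofReal hai.lintegral_lt_top.ne).1 heq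
  filter_upwards [h5] with x hx
  simp only [Pi.zero_apply, Pi.neg_apply] at hx ⊢
  rcases le_total 0 (a x) with h6 | h6
  · rw [ENNReal.ofReal_of_nonpos (neg_nonpos.2 h6), ENNReal.ofReal_eq_zero] at hx
    exact le_antisymm hx h6
  · rw [ENNReal.ofReal_of_nonpos h6, eq_comm, ENNReal.ofReal_eq_zero] at hx
    linarith

/-- Totality of the exponentials in `L²(μ)`. -/
theorem IsCanonicalGaussian.ae_eq_zero_of_integral_mul_exp {a : TestDual N → ℂ}
    (ha : MemLp a 2 μ)
    (h : ∀ η : N, ∫ x, a x * Real.exp (x η - 1 / 2 * ‖S.emb 0 η‖ ^ 2) ∂μ = 0) : a =ᵐ[μ] 0 := by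
  have h0 : ∀ η : N, ∫ x, a x * Real.exp (x η) ∂μ = 0 := by
    intro η
    have h1 : ∀ x : TestDual N, a x * Real.exp (x η) =
        a x * Real.exp (x η - 1 / 2 * ‖S.emb 0 η‖ ^ 2) * Real.exp (1 / 2 * ‖S.emb 0 η‖ ^ 2) := by
      intro x
      rw [mul_assoc, ← Complex.ofReal_mul, ← Real.exp_add, sub_add_cancel]
    simp_rw [h1]
    rw [integral_mul_const, h, zero_mul]
  have hint : ∀ η : N, Integrable (fun x => a x * Real.exp (x η)) μ := fun η => by
    simpa [Pi.mul_def] using ha.integrable_mul (hμ.memLp_exp_mul η 0)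
  have hre := hμ.ae_eq_zero_of_integral_mul_exp_real ha.re fun η => by
    have := integral_re (hint η)
    rw [h0] at this
    simpa [-Complex.ofReal_exp] using this
  have him := hμ.ae_eq_zero_of_integral_mul_exp_real ha.im fun η => by
    have := integral_im (hint η)
    rw [h0] at this
    simpa [-Complex.ofReal_exp] using this
  filter_upwards [hre, him] with x h1 h2
  exact Complex.ext h1 h2

end Totality

/-! ### Rotation invariance of μ × μ. -/

section Rotation

theorem IsCanonicalGaussian.map_rotation {c s : ℝ} (hcs : c ^ 2 + s ^ 2 = 1) :
    (μ.prod μ).map (fun v => (TestDual.comb c (-s) v.1 v.2, TestDual.comb s c v.1 v.2)) =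
      μ.prod μ := by
  have := hμ.1
  have hm : Measurable fun v : TestDual N × TestDual N =>
      (TestDual.comb c (-s) v.1 v.2, TestDual.comb s c v.1 v.2) := by
    refine Measurable.prodMk (TestDual.measurable_of_eval fun ξ => ?_)
      (TestDual.measurable_of_eval fun ξ => ?_) <;>
    · simp_rw [TestDual.comb_apply]
      fun_prop
  have : IsProbabilityMeasure ((μ.prod μ).map fun v : TestDual N × TestDual N =>
      (TestDual.comb c (-s) v.1 v.2, TestDual.comb s c v.1 v.2)) :=
    Measure.isProbabilityMeasure_map hm.aemeasurable
  have hchar : ∀ ξ ζ : N, ∫ v : TestDual N × TestDual N,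
      Complex.exp (Complex.I * ((v.1 ξ + v.2 ζ : ℝ) : ℂ)) ∂(μ.prod μ) =
      Real.exp (-(1 / 2) * (‖S.emb 0 ξ‖ ^ 2 + ‖S.emb 0 ζ‖ ^ 2)) := by
    intro ξ ζ
    have h1 : ∀ v : TestDual N × TestDual N, Complex.exp (Complex.I * ((v.1 ξ + v.2 ζ : ℝ) : ℂ)) =
        Complex.exp (Complex.I * v.1 ξ) * Complex.exp (Complex.I * v.2 ζ) := by
      intro v
      rw [← Complex.exp_add]
      push_cast
      ring_nf
    simp_rw [h1]
    rw [integral_prod_mul (fun x : TestDual N => Complex.exp (Complex.I * x ξ))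
      (fun x : TestDual N => Complex.exp (Complex.I * x ζ)), hμ.2, hμ.2, ← Complex.ofReal_mul,
      ← Real.exp_add]
    ring_nf
  refine measure_ext_of_charFun_linear (I := N × N) (fun i v => v.1 i.1 + v.2 i.2)
    (fun i j v => ?_) (fun r i v => ?_) ?_ _ _ fun i => ?_
  · simp only [Prod.fst_add, Prod.snd_add, TestDual.map_add]
    ring
  · simp only [Prod.smul_fst, Prod.smul_snd, TestDual.map_smul]
    ring
  -- The pairs (ξ, 0) and (0, ξ) already generate the product σ-algebra.
  · apply le_antisymm
    · refine sup_le ?_ ?_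
      · rw [instMeasurableSpaceTestDual, MeasurableSpace.comap_iSup]
        refine iSup_le fun ξ => le_iSup_of_le ((ξ, 0) : N × N) ?_
        rw [MeasurableSpace.comap_comp]
        have : ∀ x : TestDual N, x 0 = 0 := fun x => by simpa using x.map_smul 0 0
        simp only [this, add_zero]
        exact le_rfl
      · rw [instMeasurableSpaceTestDual, MeasurableSpace.comap_iSup]
        refine iSup_le fun ξ => le_iSup_of_le ((0, ξ) : N × N) ?_
        rw [MeasurableSpace.comap_comp]
        have : ∀ x : TestDual N, x 0 = 0 := fun x => by simpa using x.map_smul 0 0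
        simp only [this, zero_add]
        exact le_rfl
    · refine iSup_le fun i => ?_
      have : Measurable fun v : TestDual N × TestDual N => v.1 i.1 + v.2 i.2 := by fun_prop
      exact this.comap_le
  · rw [integral_map hm.aemeasurable (by
      exact (by fun_prop : Measurable fun v : TestDual N × TestDual N =>
        Complex.exp (Complex.I * ((v.1 i.1 + v.2 i.2 : ℝ) : ℂ))).aestronglyMeasurable)]
    have h2 : ∀ v : TestDual N × TestDual N,
        TestDual.comb c (-s) v.1 v.2 i.1 + TestDual.comb s c v.1 v.2 i.2 =
        v.1 (c • i.1 + s • i.2) + v.2 (c • i.2 + (-s) • i.1) := by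
      intro v
      simp only [TestDual.comb_apply, TestDual.map_add, TestDual.map_smul]
      ring
    simp_rw [h2]
    rw [hchar, hchar]
    congr 3
    simp only [map_add, map_smul, @norm_add_sq_real, norm_smul, inner_smul_left, inner_smul_right,
      mul_pow, Real.norm_eq_abs, sq_abs, neg_sq, real_inner_comm (S.emb 0 i.1) (S.emb 0 i.2)]
    simp only [conj_trivial]
    linear_combination (‖S.emb 0 i.1‖ ^ 2 + ‖S.emb 0 i.2‖ ^ 2) * hcs

end Rotation

end NuclearTriple

/-- Measurability with respect to the cylinder σ-algebra of the complexification of `N'`. -/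
def IsCylMeasurable {N : Type*} [AddCommGroup N] [Module ℝ N] [TopologicalSpace N]
    (G : (N →L[ℝ] ℂ) → ℂ) : Prop :=
  @Measurable _ _ (⨆ ξ : N, MeasurableSpace.comap (fun z : N →L[ℝ] ℂ => z ξ) (borel ℂ)) _ G

theorem IsCylMeasurable.comp {N : Type*} [AddCommGroup N] [Module ℝ N] [TopologicalSpace N]
    {G : (N →L[ℝ] ℂ) → ℂ} (hG : IsCylMeasurable G) {α : Type*} [MeasurableSpace α]
    {g : α → (N →L[ℝ] ℂ)} (hg : ∀ ξ, Measurable fun a => g a ξ) : Measurable fun a => G (g a) := by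
  let m : MeasurableSpace (N →L[ℝ] ℂ) :=
    ⨆ ξ : N, MeasurableSpace.comap (fun z : N →L[ℝ] ℂ => z ξ) (borel ℂ)
  have h1 : Measurable g := by
    refine Measurable.of_le_map (iSup_le fun ξ => ?_)
    rw [MeasurableSpace.comap_le_iff_le_map, MeasurableSpace.map_comp]
    intro A hA
    exact hg ξ hA
  exact Measurable.comp hG h1

theorem isCylMeasurable_eval {N : Type*} [AddCommGroup N] [Module ℝ N] [TopologicalSpace N]
    (ξ : N) : IsCylMeasurable fun z : N →L[ℝ] ℂ => z ξ := by
  refine measurable_iff_comap_le.2 ?_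
  exact le_iSup (fun ξ : N => MeasurableSpace.comap (fun z : N →L[ℝ] ℂ => z ξ) (borel ℂ)) ξ

/-! ### Gaussian averages in imaginary directions. -/

namespace NuclearTriple

variable {N : Type*} [AddCommGroup N] [Module ℝ N] [TopologicalSpace N]
  {H : ℕ → Type*} [∀ p, NormedAddCommGroup (H p)] [∀ p, InnerProductSpace ℝ (H p)]
  [∀ p, CompleteSpace (H p)] (S : NuclearTriple N H)

/-- Measurable functions that are entire on the complexification of `H_{-p}`, with the growth bound
`M e^{ε |z|_{-p}}`. -/
structure IsExpBounded (p : ℕ) (M ε : ℝ) (G : (N →L[ℝ] ℂ) → ℂ) : Prop where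
  eps_nonneg : 0 ≤ ε
  differentiable : ∀ y z : N →L[ℝ] ℂ, S.dualNormC p y < ⊤ → S.dualNormC p z < ⊤ →
    Differentiable ℂ fun t : ℂ => G (y + t • z)
  norm_le : ∀ z, S.dualNormC p z < ⊤ → ‖G z‖ ≤ M * Real.exp (ε * (S.dualNormC p z).toReal)
  measurable : IsCylMeasurable G

/-- The Gaussian average `∫ G(z + i y) dμ(y)`. -/
def imAverage (μ : Measure (TestDual N)) (G : (N →L[ℝ] ℂ) → ℂ) (z : N →L[ℝ] ℂ) : ℂ :=
  ∫ y : TestDual N, G (z + Complex.I • y.toComplex) ∂μ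

theorem dualNormC_zero (p : ℕ) : S.dualNormC p 0 = 0 := by
  obtain ⟨ι, hι, ⟨B⟩⟩ := S.exists_adaptedBasis p
  simp [B.dualNormC_eq]

variable {S} {μ : Measure (TestDual N)} (hμ : S.IsCanonicalGaussian μ) {p : ℕ}
  (hp : IsHilbertSchmidt (S.incl p)) {M ε : ℝ} {G : (N →L[ℝ] ℂ) → ℂ}
  (hG : S.IsExpBounded p M ε G)

include hG in
theorem IsExpBounded.nonneg : 0 ≤ M := by
  have h := hG.norm_le 0 (by simp [dualNormC_zero])
  rw [dualNormC_zero] at h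
  simpa using (norm_nonneg _).trans h

include hG in
theorem IsExpBounded.norm_add_I_smul_le {z : N →L[ℝ] ℂ} (hz : S.dualNormC p z < ⊤)
    {y : TestDual N} (hy : S.dualNorm p y < ⊤) :
    ‖G (z + Complex.I • y.toComplex)‖ ≤ M * Real.exp (ε * (S.dualNormC p z).toReal) *
      Real.exp (ε * (S.dualNorm p y).toReal) := by
  have hε := hG.eps_nonneg
  have hM := hG.nonneg
  rw [← dualNormC_toComplex] at hy ⊢
  refine (hG.norm_le _ (S.dualNormC_add_smul_lt_top hz hy _)).trans ?_
  rw [mul_assoc, ← Real.exp_add, ← mul_add]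
  gcongr
  simpa using S.toReal_dualNormC_add_smul_le hz hy Complex.I

include hμ hp hG

/-- This is where the constant C_{p,ε} arises: the exponential bound on z + iy factors through the
triangle inequality, for almost every y. -/
theorem IsExpBounded.norm_imAverage_le {z : N →L[ℝ] ℂ} (hz : S.dualNormC p z < ⊤) :
    ‖imAverage μ G z‖ ≤ M * Real.exp (ε * (S.dualNormC p z).toReal) *
      ∫ y, Real.exp (ε * (S.dualNorm p y).toReal) ∂μ := by
  rw [← integral_const_mul]
  refine norm_integral_le_of_norm_le ((hμ.integrable_exp_dualNorm hp ε).const_mul _) ?_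
  filter_upwards [hμ.ae_dualNorm_lt_top hp] with y hy using hG.norm_add_I_smul_le hz hy

theorem IsExpBounded.differentiable_imAverage {y z : N →L[ℝ] ℂ} (hy : S.dualNormC p y < ⊤)
    (hz : S.dualNormC p z < ⊤) : Differentiable ℂ fun t : ℂ => imAverage μ G (y + t • z) := by
  have hM := hG.nonneg
  have hε := hG.eps_nonneg
  apply differentiable_integral_of_dominated
  · intro t
    refine (hG.measurable.comp fun ξ => ?_).aestronglyMeasurable
    simp only [add_apply, smul_apply, smul_eq_mul]
    fun_prop
  · filter_upwards [hμ.ae_dualNorm_lt_top hp] with w hw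
    rw [← dualNormC_toComplex] at hw
    have := hG.differentiable _ z (S.dualNormC_add_smul_lt_top hy hw Complex.I) hz
    simpa [add_right_comm] using this
  · intro R
    refine ⟨_, (hμ.integrable_exp_dualNorm hp ε).const_mul
      (M * Real.exp (ε * ((S.dualNormC p y).toReal + R * (S.dualNormC p z).toReal))), ?_⟩
    filter_upwards [hμ.ae_dualNorm_lt_top hp] with w hw t ht
    refine (hG.norm_add_I_smul_le (S.dualNormC_add_smul_lt_top hy hz t) hw).trans ?_
    gcongr
    refine (S.toReal_dualNormC_add_smul_le hy hz t).trans ?_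
    gcongr

omit hp hG in
theorem stronglyMeasurable_imAverage (hG : IsCylMeasurable G) :
    StronglyMeasurable fun x : TestDual N => imAverage μ G x.toComplex := by
  have := hμ.1
  have h : Measurable fun v : TestDual N × TestDual N =>
      G (v.1.toComplex + Complex.I • v.2.toComplex) := by
    refine hG.comp fun ξ => ?_
    simp only [add_apply, smul_apply, smul_eq_mul, TestDual.toComplex_apply]
    fun_prop
  exact h.stronglyMeasurable.integral_prod_right'

theorem IsExpBounded.memLp_imAverage :
    MemLp (fun x : TestDual N => imAverage μ G x.toComplex) 2 μ := by
  have hdm := S.measurable_dualNorm p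
  have h1 : MemLp (fun x => Real.exp (ε * (S.dualNorm p x).toReal)) 2 μ := by
    rw [memLp_two_iff_integrable_sq (by
      exact (by fun_prop : Measurable fun x =>
        Real.exp (ε * (S.dualNorm p x).toReal)).aestronglyMeasurable)]
    convert hμ.integrable_exp_dualNorm hp (2 * ε) using 2 with x
    rw [← Real.exp_nat_mul]
    push_cast
    ring_nf
  refine (h1.const_mul (M * ∫ y, Real.exp (ε * (S.dualNorm p y).toReal) ∂μ)).of_le
    (stronglyMeasurable_imAverage hμ hG.measurable).aestronglyMeasurable ?_
  filter_upwards [hμ.ae_dualNorm_lt_top hp] with x hx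
  rw [← dualNormC_toComplex] at hx
  refine (hG.norm_imAverage_le hμ hp hx).trans (le_trans (le_of_eq ?_) (Real.le_norm_self _))
  rw [dualNormC_toComplex]
  ring

/-- The mean value property of the complex Gaussian measure. -/
theorem IsExpBounded.integral_imAverage_shift (η : N) :
    ∫ x, imAverage μ G (TestDual.comb 1 1 x (S.toDual η)).toComplex ∂μ =
      G (S.toDual η).toComplex := by
  have := hμ.1
  have hM := hG.nonneg
  have hε := hG.eps_nonneg
  set j := (S.toDual η).toComplex with hj
  have hjn : S.dualNormC p j < ⊤ := by
    rw [hj, dualNormC_toComplex]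
    exact S.dualNorm_toDual_lt_top p η
  -- The parameter t scales the complex Gaussian x + iy. Its mean `K t` is G(j) at t = 0 and the
  -- required integral at t = 1.
  let F : ℂ → TestDual N × TestDual N → ℂ := fun t v =>
    G (j + t • (v.1.toComplex + Complex.I • v.2.toComplex))
  have hFm : ∀ t, Measurable (F t) := by
    intro t
    refine hG.measurable.comp fun ξ => ?_
    simp only [add_apply, smul_apply, smul_eq_mul, TestDual.toComplex_apply]
    fun_prop
  have hae : ∀ᵐ v ∂(μ.prod μ), S.dualNorm p v.1 < ⊤ ∧ S.dualNorm p v.2 < ⊤ := by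
    have h1 := (Measure.quasiMeasurePreserving_fst (μ := μ) (ν := μ)).ae
      (hμ.ae_dualNorm_lt_top hp)
    have h2 := (Measure.quasiMeasurePreserving_snd (μ := μ) (ν := μ)).ae
      (hμ.ae_dualNorm_lt_top hp)
    filter_upwards [h1, h2] with v a b using ⟨a, b⟩
  have hsum : ∀ v : TestDual N × TestDual N, S.dualNorm p v.1 < ⊤ → S.dualNorm p v.2 < ⊤ →
      S.dualNormC p (v.1.toComplex + Complex.I • v.2.toComplex) < ⊤ ∧
      (S.dualNormC p (v.1.toComplex + Complex.I • v.2.toComplex)).toReal ≤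
        (S.dualNorm p v.1).toReal + (S.dualNorm p v.2).toReal := by
    intro v h1 h2
    rw [← dualNormC_toComplex] at h1 h2
    refine ⟨S.dualNormC_add_smul_lt_top h1 h2 _, ?_⟩
    simpa [dualNormC_toComplex] using S.toReal_dualNormC_add_smul_le h1 h2 Complex.I
  have hbound : ∀ R : ℝ, ∃ b : TestDual N × TestDual N → ℝ, Integrable b (μ.prod μ) ∧
      ∀ᵐ v ∂(μ.prod μ), ∀ t : ℂ, ‖t‖ ≤ R → ‖F t v‖ ≤ b v := by
    intro R
    refine ⟨_, (((hμ.integrable_exp_dualNorm hp (ε * R)).mul_prod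
      (hμ.integrable_exp_dualNorm hp (ε * R))).const_mul
      (M * Real.exp (ε * (S.dualNormC p j).toReal))), ?_⟩
    filter_upwards [hae] with v hv t ht
    obtain ⟨h1, h2⟩ := hsum v hv.1 hv.2
    refine (hG.norm_le _ (S.dualNormC_add_smul_lt_top hjn h1 t)).trans ?_
    rw [mul_assoc, ← Real.exp_add, ← Real.exp_add]
    gcongr
    have hR : 0 ≤ R := (norm_nonneg t).trans ht
    calc ε * _ ≤ ε * ((S.dualNormC p j).toReal +
          R * ((S.dualNorm p v.1).toReal + (S.dualNorm p v.2).toReal)) := by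
          refine mul_le_mul_of_nonneg_left
            ((S.toReal_dualNormC_add_smul_le hjn h1 t).trans ?_) hε
          gcongr
      _ = _ := by ring
  let K : ℂ → ℂ := fun t => ∫ v, F t v ∂(μ.prod μ)
  have hK : Differentiable ℂ K := by
    refine differentiable_integral_of_dominated (fun t => (hFm t).aestronglyMeasurable) ?_ hbound
    filter_upwards [hae] with v hv
    exact hG.differentiable _ _ hjn (hsum v hv.1 hv.2).1
  -- Multiplying x + iy by a unimodular t rotates the pair (x, y), which preserves μ × μ. So `K` is
  -- constant on the unit circle and equals its circle average `K 0`.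
  have hrot : ∀ t ∈ Metric.sphere (0 : ℂ) |1|, K t = K 1 := by
    intro t ht
    have ht1 : ‖t‖ = 1 := by simpa using ht
    have hcs : t.re ^ 2 + t.im ^ 2 = 1 := by
      have := Complex.sq_norm t
      rw [ht1, Complex.normSq_apply] at this
      linarith
    have hm : Measurable fun v : TestDual N × TestDual N =>
        (TestDual.comb t.re (-t.im) v.1 v.2, TestDual.comb t.im t.re v.1 v.2) := by
      refine Measurable.prodMk (TestDual.measurable_of_eval fun ξ => ?_)
        (TestDual.measurable_of_eval fun ξ => ?_) <;>
      · simp_rw [TestDual.comb_apply]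
        fun_prop
    change _ = ∫ v, F 1 v ∂(μ.prod μ)
    rw [← hμ.map_rotation hcs, integral_map hm.aemeasurable (hFm 1).aestronglyMeasurable]
    refine integral_congr_ae (Eventually.of_forall fun v => ?_)
    simp only [F]
    congr 2
    ext ξ
    simp only [smul_apply, add_apply, smul_eq_mul, TestDual.toComplex_apply, TestDual.comb_apply]
    conv_lhs => rw [← Complex.re_add_im t]
    push_cast
    linear_combination (t.im * v.2 ξ : ℂ) * Complex.I_sq
  have hcirc : K 0 = K 1 := by
    rw [← DiffContOnCl.circleAverage (R := 1) (c := 0) hK.diffContOnCl]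
    exact Real.circleAverage_const_on_circle hrot
  have hK0 : K 0 = G j := by
    have h0 : ∀ v, F 0 v = G j := fun v => congrArg G (by ext ξ; simp)
    simp [K, h0]
  have hint1 : Integrable (F 1) (μ.prod μ) := by
    obtain ⟨b, hb, hle⟩ := hbound 1
    refine hb.mono' (hFm 1).aestronglyMeasurable ?_
    filter_upwards [hle] with v hv using hv 1 (by simp)
  rw [← hK0, hcirc]
  change _ = ∫ v, F 1 v ∂(μ.prod μ)
  rw [integral_prod _ hint1]
  refine integral_congr_ae (Eventually.of_forall fun x => ?_)
  simp only [imAverage, F]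
  refine integral_congr_ae (Eventually.of_forall fun y => ?_)
  simp only
  congr 1
  rw [TestDual.toComplex_comb, ← hj]
  simp only [Complex.ofReal_one, one_smul]
  abel

end NuclearTriple

/-! ### Support of μ and uniqueness of entire versions. -/

namespace NuclearTriple

variable {N : Type*} [AddCommGroup N] [Module ℝ N] [TopologicalSpace N]
  {H : ℕ → Type*} [∀ p, NormedAddCommGroup (H p)] [∀ p, InnerProductSpace ℝ (H p)]
  [∀ p, CompleteSpace (H p)] (S : NuclearTriple N H)

/-- The Riesz representation of elements of `H_{-p}`. -/
theorem exists_inner_eq_of_dualNorm_lt_top {p : ℕ} {x : TestDual N} (hx : S.dualNorm p x < ⊤) :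
    ∃ v : H p, ∀ ξ, x ξ = inner ℝ v (S.emb p ξ) := by
  obtain ⟨ι, hι, ⟨B⟩⟩ := S.exists_adaptedBasis p
  rw [← dualNormC_toComplex, B.dualNormC_lt_top_iff] at hx
  have hmem : Memℓp (fun k => x (B.vec k)) 2 := by
    refine memℓp_gen ?_
    simpa [TestDual.toComplex_apply] using hx
  let v : H p := B.basis.repr.symm ⟨_, hmem⟩
  have hv : ∀ k, inner ℝ v (S.emb p (B.vec k)) = x (B.vec k) := by
    intro k
    rw [B.emb_vec, real_inner_comm, ← HilbertBasis.repr_apply_apply,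
      LinearIsometryEquiv.apply_symm_apply]
  refine ⟨v, fun ξ => ?_⟩
  -- The difference of the two functionals vanishes on the adapted basis, hence on N.
  let z : N →L[ℝ] ℂ := x.toComplex - Complex.ofRealCLM.comp ((innerSL ℝ v).comp (S.emb p))
  have hz : ∀ ξ, z ξ = ((x ξ - inner ℝ v (S.emb p ξ) : ℝ) : ℂ) := fun ξ => by
    simp [z, TestDual.toComplex_apply]
  have h := B.norm_apply_le z (by simp [hz, hv]) ξ
  simp only [hz, hv, sub_self, Complex.ofReal_zero, norm_zero, ne_eq, OfNat.ofNat_ne_zero,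
    not_false_eq_true, zero_pow, tsum_zero, Real.sqrt_zero, zero_mul, norm_le_zero_iff,
    Complex.ofReal_eq_zero] at h
  exact sub_eq_zero.1 h

/-- The orthogonal complement of the range of the adjoint is the kernel of the embedding, which is
zero. The adjoint sends η ∈ N to its Riesz representative in `H p`, so this underlies the density of
N in H_{-p}. -/
theorem denseRange_adjoint_incl (p : ℕ) :
    DenseRange (ContinuousLinearMap.adjoint (S.incl p)) := by
  have h := ContinuousLinearMap.orthogonal_range (ContinuousLinearMap.adjoint (S.incl p))
  rw [ContinuousLinearMap.adjoint_adjoint, LinearMap.ker_eq_bot.2 (S.incl_injective p),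
    ← Submodule.topologicalClosure_eq_top_iff] at h
  rw [DenseRange, dense_iff_closure_eq]
  have h2 := congrArg (fun V : Submodule ℝ (H p) => (V : Set (H p))) h
  rw [Submodule.topologicalClosure_coe, Submodule.top_coe] at h2
  exact h2

/-- `N` is dense in `H_{-p}`. -/
theorem exists_dualNorm_sub_toDual_lt {d : ℕ → N} (hd : DenseRange d) {p : ℕ} {x : TestDual N}
    (hx : S.dualNorm p x < ⊤) {r : ℝ} (hr : 0 < r) :
    ∃ n, S.dualNorm p (TestDual.comb 1 (-1) x (S.toDual (d n))) < ENNReal.ofReal r := by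
  obtain ⟨v, hv⟩ := S.exists_inner_eq_of_dualNorm_lt_top hx
  have hdense : DenseRange fun n => ContinuousLinearMap.adjoint (S.incl p) (S.emb 0 (d n)) :=
    (S.denseRange_adjoint_incl p).comp ((S.emb_dense 0).comp hd (S.emb 0).continuous)
      (ContinuousLinearMap.adjoint (S.incl p)).continuous
  obtain ⟨n, hn⟩ := hdense.exists_dist_lt v (half_pos hr)
  refine ⟨n, lt_of_le_of_lt (b := ENNReal.ofReal (r / 2)) (iSup₂_le fun ξ hξ => ?_)
    ((ENNReal.ofReal_lt_ofReal_iff hr).2 (half_lt_self hr))⟩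
  rw [← ofReal_norm]
  refine ENNReal.ofReal_le_ofReal ?_
  have h1 : TestDual.comb 1 (-1) x (S.toDual (d n)) ξ =
      inner ℝ (v - ContinuousLinearMap.adjoint (S.incl p) (S.emb 0 (d n))) (S.emb p ξ) := by
    rw [TestDual.comb_apply, hv, toDual_apply, inner_sub_left,
      ContinuousLinearMap.adjoint_inner_left, S.incl_emb]
    ring
  rw [h1]
  rw [dist_eq_norm] at hn
  exact (norm_inner_le_norm _ _).trans
    ((mul_le_of_le_one_right (norm_nonneg _) hξ).trans hn.le)

/-- Entire functions on the complexification of `H_{-p}`. -/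
structure IsEntireOn (p : ℕ) (G : (N →L[ℝ] ℂ) → ℂ) : Prop where
  differentiable : ∀ y z : N →L[ℝ] ℂ, S.dualNormC p y < ⊤ → S.dualNormC p z < ⊤ →
    Differentiable ℂ fun t : ℂ => G (y + t • z)
  locally_bounded : ∀ y : N →L[ℝ] ℂ, S.dualNormC p y < ⊤ →
    ∃ r > 0, ∃ C : ℝ, ∀ z, S.dualNormC p (z - y) < r → ‖G z‖ ≤ C

variable {S}

theorem IsEntireOn.sub {p : ℕ} {F G : (N →L[ℝ] ℂ) → ℂ} (hF : S.IsEntireOn p F)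
    (hG : S.IsEntireOn p G) : S.IsEntireOn p fun z => F z - G z := by
  refine ⟨fun y z hy hz => (hF.differentiable y z hy hz).sub (hG.differentiable y z hy hz),
    fun y hy => ?_⟩
  obtain ⟨r, hr, C, hC⟩ := hF.locally_bounded y hy
  obtain ⟨s, hs, D, hD⟩ := hG.locally_bounded y hy
  refine ⟨min r s, lt_min hr hs, C + D, fun z hz => ?_⟩
  exact (norm_sub_le _ _).trans (add_le_add (hC z (hz.trans_le (min_le_left _ _)))
    (hD z (hz.trans_le (min_le_right _ _))))

/-- On the complex line through y and z, G is bounded by C on a disc of radius s/ρ, so the Schwarz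
lemma gives |G(z) - G(y)| ≤ 2Cρ/s. -/
theorem IsEntireOn.continuous_at {p : ℕ} {G : (N →L[ℝ] ℂ) → ℂ} (hG : S.IsEntireOn p G)
    {y : N →L[ℝ] ℂ} (hy : S.dualNormC p y < ⊤) {δ : ℝ} (hδ : 0 < δ) :
    ∃ ρ : ℝ, 0 < ρ ∧ ∀ z, S.dualNormC p (z - y) < ENNReal.ofReal ρ → ‖G z - G y‖ < δ := by
  obtain ⟨r, hr, C, hC⟩ := hG.locally_bounded y hy
  obtain ⟨s, hs0, hsr⟩ := ENNReal.lt_iff_exists_real_btwn.1 hr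
  have hs : 0 < s := by simpa using hsr.1
  have hC0 : 0 ≤ C := (norm_nonneg _).trans (hC y (by simpa [dualNormC_zero] using hr))
  -- The first entry puts t = 1 inside the disc of radius s/ρ; the second makes 2Cρ/s < δ, with 2C +
  -- 1 instead of 2C in case C = 0.
  let ρ := min (s / 2) (δ * s / (2 * (2 * C + 1)))
  have hρ : 0 < ρ := lt_min (by positivity) (by positivity)
  refine ⟨ρ, hρ, fun z hz => ?_⟩
  have hz' : S.dualNormC p (z - y) < ⊤ := hz.trans ENNReal.ofReal_lt_top
  let f : ℂ → ℂ := fun t => G (y + t • (z - y))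
  have hf : Differentiable ℂ f := hG.differentiable y (z - y) hy hz'
  have hf0 : f 0 = G y := congrArg G (by ext; simp)
  have hf1 : f 1 = G z := congrArg G (by ext; simp)
  have hb : ∀ t ∈ Metric.ball (0 : ℂ) (s / ρ), ‖f t‖ ≤ C := by
    intro t ht
    apply hC
    rw [add_sub_cancel_left, dualNormC_smul]
    refine lt_of_le_of_lt ?_ hsr.2
    rw [← ofReal_norm]
    have ht' : ‖t‖ < s / ρ := by simpa using ht
    calc ENNReal.ofReal ‖t‖ * S.dualNormC p (z - y)
        ≤ ENNReal.ofReal (s / ρ) * ENNReal.ofReal ρ := by gcongr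
      _ = ENNReal.ofReal s := by
        rw [← ENNReal.ofReal_mul (by positivity), div_mul_cancel₀ _ hρ.ne']
  have hsρ : 1 < s / ρ := by
    rw [one_lt_div hρ]
    exact (min_le_left _ _).trans_lt (half_lt_self hs)
  have h1 := Complex.dist_le_div_mul_dist_of_mapsTo_ball (f := f) (c := 0) (z := 1) (R₁ := s / ρ)
    (R₂ := 2 * C) hf.differentiableOn (fun t ht => ?_) (by simpa using hsρ)
  · rw [hf0, hf1, dist_eq_norm, dist_eq_norm, sub_zero, norm_one, mul_one] at h1
    refine h1.trans_lt ?_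
    have h2 : 2 * C / (s / ρ) = 2 * C * ρ / s := by field_simp
    rw [h2, div_lt_iff₀ hs]
    calc 2 * C * ρ ≤ 2 * C * (δ * s / (2 * (2 * C + 1))) := by
          gcongr
          exact min_le_right _ _
      _ < δ * s := by
          rw [mul_div_assoc', div_lt_iff₀ (by positivity)]
          nlinarith [mul_pos hδ hs]
  · rw [Metric.mem_closedBall, dist_eq_norm]
    have h0 : (0 : ℂ) ∈ Metric.ball (0 : ℂ) (s / ρ) := by simpa using zero_lt_one.trans hsρ
    exact (norm_sub_le _ _).trans (by linarith [hb t ht, hb 0 h0])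

section Support

variable {μ : Measure (TestDual N)} (hμ : S.IsCanonicalGaussian μ) {p : ℕ}
  (hp : IsHilbertSchmidt (S.incl p))
include hμ hp

/-- Balls in `H_{-p}` have positive measure. -/
theorem IsCanonicalGaussian.measure_ball_ne_zero {x : TestDual N} (hx : S.dualNorm p x < ⊤)
    {r : ℝ} (hr : 0 < r) :
    μ {y | S.dualNorm p (TestDual.comb 1 (-1) y x) < ENNReal.ofReal r} ≠ 0 := by
  have := hμ.1
  have := S.separable
  let d : ℕ → N := TopologicalSpace.denseSeq N
  have hd : DenseRange d := TopologicalSpace.denseRange_denseSeq N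
  let A : ℕ → Set (TestDual N) := fun n =>
    {y | S.dualNorm p (TestDual.comb 1 (-1) y (S.toDual (d n))) < ENNReal.ofReal (r / 2)}
  -- Countably many balls with centres in N cover H_{-p}, a set of full measure.
  obtain ⟨n, hn⟩ : ∃ n, μ (A n) ≠ 0 := by
    by_contra! hcon
    have h1 : μ (⋃ n, A n) = 0 := measure_iUnion_null hcon
    have h2 : ∀ᵐ y ∂μ, y ∈ ⋃ n, A n := by
      filter_upwards [hμ.ae_dualNorm_lt_top hp] with y hy
      exact Set.mem_iUnion.2 (S.exists_dualNorm_sub_toDual_lt hd hy (half_pos hr))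
    have h3 : μ Set.univ = 0 := by
      have h4 : (⋃ n, A n) =ᵐ[μ] (Set.univ : Set (TestDual N)) := eventuallyEq_univ.2 h2
      rw [← measure_congr h4, h1]
    simp at h3
  obtain ⟨m, hm⟩ := S.exists_dualNorm_sub_toDual_lt hd hx (half_pos hr)
  intro h0
  apply hn
  -- Translation by η carries the ball of radius r/2 about `d n` into the ball of radius r about x,
  -- because `d m` is within r/2 of x. Cameron-Martin absolute continuity then transfers nullity
  -- back.
  let η := d m - d n
  have h1 := hμ.map_shift_absolutelyContinuous η h0
  have hmeas : MeasurableSet {y | S.dualNorm p (TestDual.comb 1 (-1) y x) < ENNReal.ofReal r} := by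
    refine measurableSet_lt ((S.measurable_dualNorm p).comp
      (TestDual.measurable_of_eval fun ξ => ?_)) measurable_const
    simp_rw [TestDual.comb_apply]
    fun_prop
  rw [Measure.map_apply (S.measurable_shift η) hmeas] at h1
  refine measure_mono_null (fun y hy => ?_) h1
  simp only [A, Set.mem_ofPred_eq] at hy
  simp only [Set.mem_preimage, Set.mem_ofPred_eq]
  rw [← dualNormC_toComplex] at hy hm ⊢
  have h2 : (TestDual.comb 1 (-1) (TestDual.comb 1 1 y (S.toDual η)) x).toComplex =
      (TestDual.comb 1 (-1) y (S.toDual (d n))).toComplex +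
        (-1 : ℂ) • (TestDual.comb 1 (-1) x (S.toDual (d m))).toComplex := by
    ext ξ
    simp only [add_apply, smul_apply, smul_eq_mul, TestDual.toComplex_apply, TestDual.comb_apply,
      toDual_apply, η, map_sub, inner_sub_left]
    push_cast
    ring
  rw [h2]
  refine (S.dualNormC_add_le p _ _).trans_lt ?_
  rw [dualNormC_smul, enorm_neg, enorm_one, one_mul, ← add_halves r,
    ENNReal.ofReal_add (by positivity) (by positivity)]
  exact ENNReal.add_lt_add hy hm

/-- Entire functions on the complexification of `H_{-p}` are determined by their values at almost
all points of `N'`. -/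
theorem IsEntireOn.eq_zero_of_ae {G : (N →L[ℝ] ℂ) → ℂ} (hG : S.IsEntireOn p G)
    (h0 : ∀ᵐ x ∂μ, G x.toComplex = 0) {z : N →L[ℝ] ℂ} (hz : S.dualNormC p z < ⊤) : G z = 0 := by
  have hreal : ∀ x : TestDual N, S.dualNorm p x < ⊤ → G x.toComplex = 0 := by
    intro x hx
    by_contra hne
    obtain ⟨ρ, hρ, hlt⟩ := hG.continuous_at (y := x.toComplex) (by rwa [dualNormC_toComplex])
      (norm_pos_iff.2 hne)
    refine hμ.measure_ball_ne_zero hp hx hρ (measure_mono_null (fun y hy => ?_) h0)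
    intro hy0
    have h1 := hlt y.toComplex (by
      have h2 : y.toComplex - x.toComplex = (TestDual.comb 1 (-1) y x).toComplex := by
        rw [TestDual.toComplex_comb]
        ext ξ
        simp [sub_eq_add_neg]
      rw [h2, dualNormC_toComplex]
      exact hy)
    have hy0' : G y.toComplex = 0 := hy0
    rw [hy0', zero_sub, norm_neg] at h1
    exact lt_irrefl _ h1
  have hre : S.dualNorm p (rePart z) < ⊤ ∧ S.dualNorm p (imPart z) < ⊤ := by
    rw [dualNormC, ENNReal.rpow_lt_top_iff_of_pos (by norm_num), ENNReal.add_lt_top] at hz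
    simpa using hz
  have h1 := hG.differentiable (rePart z).toComplex (imPart z).toComplex
    (by rw [dualNormC_toComplex]; exact hre.1) (by rw [dualNormC_toComplex]; exact hre.2)
  -- On t ↦ Re z + t Im z the function vanishes for real t, hence at t = i, which is z.
  have h2 := congrFun (entire_eq_of_eq_on_line h1 (differentiable_const (0 : ℂ)) one_ne_zero
    fun s => ?_) Complex.I
  · rw [toComplex_rePart_add] at h2
    exact h2
  · have h3 : (rePart z).toComplex + ((s : ℂ) * 1) • (imPart z).toComplex =
        (TestDual.comb 1 s (rePart z) (imPart z)).toComplex := by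
      rw [TestDual.toComplex_comb]
      ext ξ
      simp
    rw [h3]
    apply hreal
    rw [← dualNormC_toComplex, ← h3]
    exact S.dualNormC_add_smul_lt_top (by rw [dualNormC_toComplex]; exact hre.1)
      (by rw [dualNormC_toComplex]; exact hre.2) _

theorem IsEntireOn.eq_of_ae {F G : (N →L[ℝ] ℂ) → ℂ} (hF : S.IsEntireOn p F)
    (hG : S.IsEntireOn p G) (h : ∀ᵐ x ∂μ, F x.toComplex = G x.toComplex) {z : N →L[ℝ] ℂ}
    (hz : S.dualNormC p z < ⊤) : F z = G z :=
  sub_eq_zero.1 ((hF.sub hG).eq_zero_of_ae hμ hp (h.mono fun _ hx => sub_eq_zero.2 hx) hz)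

end Support

end NuclearTriple

/-! ### Expansion of Hilbert-Schmidt forms in a basis. -/

section Summation

variable {E : Type*} [NormedAddCommGroup E] [InnerProductSpace ℝ E] {n : ℕ} {ι : Type}

theorem exists_subset_piFinset [DecidableEq ι] (u : Finset (Fin n → ι)) :
    ∃ t : Finset ι, u ⊆ Fintype.piFinset fun _ => t := by
  refine ⟨u.biUnion fun i => Finset.univ.image i, fun i hi => ?_⟩
  rw [Fintype.mem_piFinset]
  intro k
  exact Finset.mem_biUnion.2 ⟨i, hi, Finset.mem_image_of_mem i (Finset.mem_univ k)⟩

theorem sum_piFinset_le_hsNormSq [DecidableEq ι] (g : MultilinearMap ℝ (fun _ : Fin n => E) ℂ)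
    (hg : hsNormSq g < ⊤) {e : ι → E} (he : Orthonormal ℝ e) (t : Finset ι) :
    ∑ i ∈ Fintype.piFinset (fun _ : Fin n => t), ‖g (fun k => e (i k))‖ ^ 2 ≤
      (hsNormSq g).toReal := by
  refine le_trans (le_of_eq ?_) (sum_real_le_hsNormSq g hg
    (he.comp (fun k : t => (k : ι)) Subtype.val_injective))
  symm
  refine Finset.sum_bij (fun i _ k => (i k : ι)) (fun i _ => ?_) (fun i _ j _ h => ?_)
    (fun i hi => ?_) (fun i _ => rfl)
  · exact Fintype.mem_piFinset.2 fun k => (i k).2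
  · funext k
    exact Subtype.ext (congrFun h k)
  · exact ⟨fun k => ⟨i k, Fintype.mem_piFinset.1 hi k⟩, Finset.mem_univ _, rfl⟩

/-- Absolute convergence of the expansion of a Hilbert-Schmidt form in an orthonormal system. -/
theorem sum_norm_mul_prod_le (g : MultilinearMap ℝ (fun _ : Fin n => E) ℂ)
    (hg : hsNormSq g < ⊤) {e : ι → E} (he : Orthonormal ℝ e) {b : ι → ℝ} (hb0 : ∀ k, 0 ≤ b k)
    (hb : Summable fun k => b k ^ 2) (u : Finset (Fin n → ι)) :
    ∑ i ∈ u, ‖g (fun k => e (i k))‖ * ∏ k, b (i k) ≤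
      √(hsNormSq g).toReal * √(∑' k, b k ^ 2) ^ n := by
  classical
  obtain ⟨t, ht⟩ := exists_subset_piFinset u
  have hprod : ∑ i ∈ Fintype.piFinset (fun _ : Fin n => t), (∏ k, b (i k)) ^ 2 =
      (∑ k ∈ t, b k ^ 2) ^ n := by
    simp_rw [← Finset.prod_pow]
    rw [← Finset.prod_univ_sum (fun _ : Fin n => t) fun _ k => b k ^ 2]
    simp
  calc ∑ i ∈ u, ‖g (fun k => e (i k))‖ * ∏ k, b (i k)
      ≤ ∑ i ∈ Fintype.piFinset (fun _ : Fin n => t), ‖g (fun k => e (i k))‖ * ∏ k, b (i k) :=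
        Finset.sum_le_sum_of_subset_of_nonneg ht fun i _ _ =>
          mul_nonneg (norm_nonneg _) (Finset.prod_nonneg fun _ _ => hb0 _)
    _ ≤ √(∑ i ∈ Fintype.piFinset (fun _ : Fin n => t), ‖g (fun k => e (i k))‖ ^ 2) *
        √(∑ i ∈ Fintype.piFinset (fun _ : Fin n => t), (∏ k, b (i k)) ^ 2) :=
        Real.sum_mul_le_sqrt_mul_sqrt _ _ _
    _ ≤ √(hsNormSq g).toReal * √(∑' k, b k ^ 2) ^ n := by
        rw [hprod]
        gcongr
        · exact sum_piFinset_le_hsNormSq g hg he t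
        · rw [Real.sqrt_le_left (by positivity), ← pow_mul, mul_comm, pow_mul,
            Real.sq_sqrt (tsum_nonneg fun _ => sq_nonneg _)]
          gcongr
          exact hb.sum_le_tsum _ fun _ _ => sq_nonneg _

theorem hasSum_hilbertBasis_expansion [CompleteSpace E]
    (g : MultilinearMap ℝ (fun _ : Fin n => E) ℂ) (hg : hsNormSq g < ⊤) (b : HilbertBasis ι ℝ E)
    (v : E) :
    HasSum (fun i : Fin n → ι => g (fun k => b (i k)) * ∏ k, ((inner ℝ v (b (i k)) : ℝ) : ℂ))
      (g fun _ => v) := by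
  classical
  have hb : Summable fun k => |inner ℝ v (b k)| ^ 2 := by
    have h := (lp.memℓp (b.repr v)).summable (by norm_num)
    simpa [HilbertBasis.repr_apply_apply, real_inner_comm] using h
  have hsum : Summable fun i : Fin n → ι =>
      g (fun k => b (i k)) * ∏ k, ((inner ℝ v (b (i k)) : ℝ) : ℂ) := by
    refine Summable.of_norm (summable_of_sum_le (fun _ => norm_nonneg _)
      (c := √(hsNormSq g).toReal * √(∑' k, |inner ℝ v (b k)| ^ 2) ^ n) fun u => ?_)
    refine le_trans (le_of_eq (Finset.sum_congr rfl fun i _ => ?_))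
      (sum_norm_mul_prod_le g hg b.orthonormal (fun k => abs_nonneg (inner ℝ v (b k))) hb u)
    simp [norm_prod]
  -- Absolute convergence permits summation along the cubes sⁿ. By multilinearity, the sum over a
  -- cube is `g` at a partial sum of the expansion of `v`, and `g` is continuous.
  have hpi : Tendsto (fun s : Finset ι => Fintype.piFinset fun _ : Fin n => s) atTop atTop := by
    refine tendsto_atTop.2 fun u => ?_
    obtain ⟨t, ht⟩ := exists_subset_piFinset u
    filter_upwards [eventually_ge_atTop t] with s hs
    exact ht.trans (Fintype.piFinset_subset _ _ fun _ => hs)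
  have h1 := hsum.hasSum.comp hpi
  have h2 : Tendsto (fun s : Finset ι => g fun _ => ∑ k ∈ s, b.repr v k • b k) atTop
      (𝓝 (g fun _ => v)) :=
    ((continuous_of_hsNormSq_lt_top g hg).tendsto _).comp
      (tendsto_pi_nhds.2 fun _ => b.hasSum_repr v)
  have h3 : (fun s : Finset ι => g fun _ => ∑ k ∈ s, b.repr v k • b k) = fun s =>
      ∑ i ∈ Fintype.piFinset fun _ : Fin n => s,
        g (fun k => b (i k)) * ∏ k, ((inner ℝ v (b (i k)) : ℝ) : ℂ) := by
    funext s
    rw [g.map_sum_finset]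
    refine Finset.sum_congr rfl fun i _ => ?_
    rw [g.map_smul_univ, Complex.real_smul, mul_comm]
    push_cast
    simp only [HilbertBasis.repr_apply_apply, real_inner_comm]
  rw [h3] at h2
  rw [← tendsto_nhds_unique h1 h2]
  exact hsum.hasSum

end Summation

namespace NuclearTriple

variable {N : Type*} [AddCommGroup N] [Module ℝ N] [TopologicalSpace N]
  {H : ℕ → Type*} [∀ p, NormedAddCommGroup (H p)] [∀ p, InnerProductSpace ℝ (H p)]
  [∀ p, CompleteSpace (H p)] {S : NuclearTriple N H}

/-! ### The entire function of a sequence of kernels. -/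

section Series

variable {p : ℕ} {ι : Type} (B : S.AdaptedBasis p ι)
  (g : (n : ℕ) → MultilinearMap ℝ (fun _ : Fin n => H p) ℂ)

/-- The entire function `z ↦ ∑ₙ ⟨z^{⊗n}, g n⟩`, expanded in a basis. -/
def kernelSeries (z : N →L[ℝ] ℂ) : ℂ :=
  ∑' σ : (Σ n : ℕ, Fin n → ι),
    g σ.1 (fun k => B.basis (σ.2 k)) * ∏ k, z (B.vec (σ.2 k))

variable {g} {M ε : ℝ} (hg : ∀ n, hsNormSq (g n) < ⊤)
  (hbound : ∀ n, √(hsNormSq (g n)).toReal ≤ M * (ε ^ n / n.factorial))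
include hg hbound

/-- Degree n contributes at most M (εr)ⁿ/n!, where r is the ℓ² norm of b, and these bounds sum to M
e^{εr}. Leaving b free serves both the growth bound (b_k = |z(v_k)|) and locally uniform convergence
on complex lines. -/
theorem summable_kernelSeries_majorant {b : ι → ℝ} (hb0 : ∀ k, 0 ≤ b k)
    (hb : Summable fun k => b k ^ 2) :
    Summable (fun σ : (Σ n : ℕ, Fin n → ι) =>
      ‖g σ.1 (fun k => B.basis (σ.2 k))‖ * ∏ k, b (σ.2 k)) ∧
    ∑' σ : (Σ n : ℕ, Fin n → ι), ‖g σ.1 (fun k => B.basis (σ.2 k))‖ * ∏ k, b (σ.2 k) ≤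
      M * Real.exp (ε * √(∑' k, b k ^ 2)) := by
  set r := √(∑' k, b k ^ 2) with hr
  have hr0 : 0 ≤ r := Real.sqrt_nonneg _
  have hnn : ∀ σ : (Σ n : ℕ, Fin n → ι),
      0 ≤ ‖g σ.1 (fun k => B.basis (σ.2 k))‖ * ∏ k, b (σ.2 k) := fun σ =>
    mul_nonneg (norm_nonneg _) (Finset.prod_nonneg fun _ _ => hb0 _)
  have hle := fun n => sum_norm_mul_prod_le (g n) (hg n) B.basis.orthonormal hb0 hb
  have hs : ∀ n, Summable fun i : Fin n → ι =>
      ‖g n (fun k => B.basis (i k))‖ * ∏ k, b (i k) := fun n =>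
    summable_of_sum_le (fun i => hnn ⟨n, i⟩) (hle n)
  have ht : ∀ n, ∑' i : Fin n → ι, ‖g n (fun k => B.basis (i k))‖ * ∏ k, b (i k) ≤
      M * ((ε * r) ^ n / n.factorial) := by
    intro n
    refine ((hs n).tsum_le_of_sum_le (hle n)).trans ?_
    calc √(hsNormSq (g n)).toReal * r ^ n ≤ M * (ε ^ n / n.factorial) * r ^ n := by
          gcongr
          exact hbound n
      _ = _ := by rw [mul_pow]; ring
  have hexp : HasSum (fun n : ℕ => M * ((ε * r) ^ n / n.factorial)) (M * Real.exp (ε * r)) := by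
    refine HasSum.mul_left M ?_
    rw [Real.exp_eq_exp_ℝ]
    exact NormedSpace.expSeries_div_hasSum_exp (ε * r)
  have ht0 : ∀ n, 0 ≤ ∑' i : Fin n → ι, ‖g n (fun k => B.basis (i k))‖ * ∏ k, b (i k) :=
    fun n => tsum_nonneg fun i => hnn ⟨n, i⟩
  have hst : Summable fun n => ∑' i : Fin n → ι,
      ‖g n (fun k => B.basis (i k))‖ * ∏ k, b (i k) :=
    Summable.of_nonneg_of_le ht0 ht hexp.summable
  have hsum := (summable_sigma_of_nonneg hnn).2 ⟨hs, hst⟩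
  refine ⟨hsum, ?_⟩
  rw [hsum.tsum_sigma' hs, ← hexp.tsum_eq]
  exact hst.tsum_le_tsum ht hexp.summable

theorem isExpBounded_kernelSeries [Countable ι] (hε : 0 ≤ ε) :
    S.IsExpBounded p M ε (kernelSeries B g) := by
  refine ⟨hε, fun y z hy hz => ?_, fun z hz => ?_, ?_⟩
  · rw [B.dualNormC_lt_top_iff] at hy hz
    intro t₀
    let R := ‖t₀‖ + 1
    have hR : 0 ≤ R := by positivity
    let b : ι → ℝ := fun k => ‖y (B.vec k)‖ + R * ‖z (B.vec k)‖
    have hb : Summable fun k => b k ^ 2 := by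
      refine Summable.of_nonneg_of_le (fun _ => sq_nonneg _) (fun k => ?_)
        ((hy.mul_left 2).add (hz.mul_left (2 * R ^ 2)))
      simp only [b]
      nlinarith [sq_nonneg (‖y (B.vec k)‖ - R * ‖z (B.vec k)‖)]
    have hmaj := (summable_kernelSeries_majorant B hg hbound (b := b)
      (fun k => by positivity) hb).1
    have hd := Complex.differentiableOn_tsum_of_summable_norm hmaj (U := Metric.ball 0 R)
      (F := fun σ t => g σ.1 (fun k => B.basis (σ.2 k)) * ∏ k, (y + t • z) (B.vec (σ.2 k)))
      (fun σ => ?_) Metric.isOpen_ball (fun σ w hw => ?_)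
    · exact hd.differentiableAt (Metric.isOpen_ball.mem_nhds (by simp [R]))
    · simp only [add_apply, smul_apply, smul_eq_mul]
      fun_prop
    · rw [norm_mul, norm_prod]
      gcongr with k
      simp only [add_apply, smul_apply, smul_eq_mul, b]
      refine (norm_add_le _ _).trans ?_
      rw [norm_mul]
      gcongr
      have : ‖w‖ < R := by simpa using hw
      exact this.le
  · rw [B.dualNormC_lt_top_iff] at hz
    obtain ⟨h1, h2⟩ := summable_kernelSeries_majorant B hg hbound
      (b := fun k => ‖z (B.vec k)‖) (fun k => norm_nonneg _) hz
    rw [B.toReal_dualNormC]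
    refine le_trans (norm_tsum_le_tsum_norm ?_) (le_trans (le_of_eq ?_) h2)
    · simpa only [norm_mul, norm_prod] using h1
    · simp only [norm_mul, norm_prod]
  · let m : MeasurableSpace (N →L[ℝ] ℂ) :=
      ⨆ ξ : N, MeasurableSpace.comap (fun z : N →L[ℝ] ℂ => z ξ) (borel ℂ)
    have hev : ∀ ξ, Measurable fun z : N →L[ℝ] ℂ => z ξ := isCylMeasurable_eval
    change Measurable (kernelSeries B g)
    refine Measurable.tsum fun σ => ?_
    exact (Finset.measurable_prod _ fun k _ => hev _).const_mul _

theorem hasSum_kernelSeries_of_inner {x : TestDual N} {v : H p}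
    (hv : ∀ ξ, x ξ = inner ℝ v (S.emb p ξ)) :
    HasSum (fun n => g n fun _ => v) (kernelSeries B g x.toComplex) := by
  have hx : S.dualNormC p x.toComplex < ⊤ := by
    rw [dualNormC_toComplex]
    refine lt_of_le_of_lt (b := ENNReal.ofReal ‖v‖) (iSup₂_le fun ξ hξ => ?_) (by simp)
    rw [← ofReal_norm, hv]
    exact ENNReal.ofReal_le_ofReal ((norm_inner_le_norm _ _).trans
      (mul_le_of_le_one_right (norm_nonneg _) hξ))
  rw [B.dualNormC_lt_top_iff] at hx
  have h1 := (summable_kernelSeries_majorant B hg hbound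
      (b := fun k => ‖x.toComplex (B.vec k)‖) (fun k => norm_nonneg _) hx).1
  have h2 : Summable fun σ : (Σ n : ℕ, Fin n → ι) =>
      g σ.1 (fun k => B.basis (σ.2 k)) * ∏ k, x.toComplex (B.vec (σ.2 k)) :=
    Summable.of_norm (by simpa only [norm_mul, norm_prod] using h1)
  refine h2.hasSum.sigma fun n => ?_
  have h3 := hasSum_hilbertBasis_expansion (g n) (hg n) B.basis v
  simp only [TestDual.toComplex_apply, hv, B.emb_vec]
  exact h3

end Series

/-! ### Kernels over `H p` and the size of their norms. -/

section Kernels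

variable (S)

/-- The tensor power of the embedding of `H p` into `H 0` is injective. -/
theorem compLinearMap_adjoint_incl_injective {p n : ℕ}
    {g g' : MultilinearMap ℝ (fun _ : Fin n => H p) ℂ} (hg : hsNormSq g < ⊤)
    (hg' : hsNormSq g' < ⊤)
    (h : g.compLinearMap (fun _ => (ContinuousLinearMap.adjoint (S.incl p)).toLinearMap) =
      g'.compLinearMap (fun _ => (ContinuousLinearMap.adjoint (S.incl p)).toLinearMap)) :
    g = g' := by
  have hd : DenseRange (Pi.map fun _ : Fin n => ContinuousLinearMap.adjoint (S.incl p)) :=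
    DenseRange.piMap fun _ => S.denseRange_adjoint_incl p
  have h1 := hd.equalizer (continuous_of_hsNormSq_lt_top g hg)
    (continuous_of_hsNormSq_lt_top g' hg') (funext fun m => DFunLike.congr_fun h m)
  exact DFunLike.coe_injective h1

/-- By injectivity there is at most one representing form of finite norm, so the infimum is
attained. -/
theorem exists_hsNormSq_eq_kernelNormSq {p n : ℕ}
    {f : MultilinearMap ℝ (fun _ : Fin n => H 0) ℂ} (hf : S.kernelNormSq p f < ⊤) :
    ∃ g : MultilinearMap ℝ (fun _ : Fin n => H p) ℂ,
      f = g.compLinearMap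
        (fun _ => (ContinuousLinearMap.adjoint (S.incl p)).toLinearMap) ∧
      hsNormSq g = S.kernelNormSq p f ∧ hsNormSq g < ⊤ := by
  obtain ⟨g, hg⟩ := iInf_lt_iff.1 hf
  obtain ⟨hfg, hgt⟩ := iInf_lt_iff.1 hg
  refine ⟨g, hfg, le_antisymm (le_iInf₂ fun g' hfg' => ?_) (iInf₂_le g hfg), hgt⟩
  rcases lt_or_ge (hsNormSq g') ⊤ with h | h
  · rw [S.compLinearMap_adjoint_incl_injective hgt h (hfg.symm.trans hfg')]
  · exact le_top.trans h

theorem kernelNormSq_lt_top {p : ℕ} {q : ℝ}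
    {f : (n : ℕ) → MultilinearMap ℝ (fun _ : Fin n => H 0) ℂ} (hf : S.testNormSq p q f < ⊤)
    (n : ℕ) : S.kernelNormSq p (f n) < ⊤ := by
  have h1 := (ENNReal.le_tsum n).trans_lt hf
  by_contra h
  rw [not_lt, top_le_iff] at h
  rw [h, ENNReal.mul_top] at h1
  · exact lt_irrefl _ h1
  · refine mul_ne_zero (by positivity) ?_
    exact (ENNReal.rpow_pos (by norm_num) (by norm_num)).ne'

theorem sqrt_kernelNormSq_le {p : ℕ} {q : ℝ}
    {f : (n : ℕ) → MultilinearMap ℝ (fun _ : Fin n => H 0) ℂ} (hf : S.testNormSq p q f < ⊤)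
    (n : ℕ) : √(S.kernelNormSq p (f n)).toReal ≤
      √(S.testNormSq p q f).toReal * (((2 : ℝ) ^ (-q / 2)) ^ n / n.factorial) := by
  have h1 := ENNReal.toReal_mono hf.ne (ENNReal.le_tsum n)
  rw [ENNReal.toReal_mul, ENNReal.toReal_mul, ENNReal.toReal_pow, ENNReal.toReal_natCast,
    ← ENNReal.toReal_rpow, ENNReal.toReal_ofNat] at h1
  have h2 : ((n.factorial : ℝ) * ((2 : ℝ) ^ (q / 2)) ^ n) ^ 2 =
      (n.factorial : ℝ) ^ 2 * 2 ^ ((n : ℝ) * q) := by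
    rw [mul_pow, ← pow_mul, ← Real.rpow_natCast (2 ^ (q / 2)), ← Real.rpow_mul (by norm_num)]
    push_cast
    ring_nf
  rw [← h2] at h1
  have h3 := Real.sqrt_le_sqrt h1
  rw [Real.sqrt_mul (sq_nonneg _), Real.sqrt_sq (by positivity)] at h3
  rw [neg_div, Real.rpow_neg (by norm_num), inv_pow, inv_div_left, ← div_eq_mul_inv,
    le_div_iff₀ (by positivity), mul_comm]
  exact h3

theorem testNormSq_mono (p : ℕ) {q q' : ℝ} (h : q ≤ q')
    (f : (n : ℕ) → MultilinearMap ℝ (fun _ : Fin n => H 0) ℂ) :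
    S.testNormSq p q f ≤ S.testNormSq p q' f := by
  refine ENNReal.tsum_le_tsum fun n => ?_
  gcongr
  norm_num

end Kernels

end NuclearTriple

/-! ### Gaussian moments. -/

section Moments

theorem iteratedDeriv_id_mul_zero {f : ℝ → ℝ} (hf : ContDiff ℝ ⊤ f) (n : ℕ) :
    iteratedDeriv (n + 1) (fun t => t * f t) 0 = (n + 1) * iteratedDeriv n f 0 := by
  rw [iteratedDeriv_fun_mul (by fun_prop) ((hf.of_le (by simp)).contDiffAt), Finset.sum_eq_single 1]
  · simp
  · intro i _ hi
    rw [iteratedDeriv_fun_id_zero]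
    simp [hi]
  · simp

/-- The moment generating function y solves y' = vty; Leibniz at 0 turns this into a recursion for
the moments. -/
theorem iteratedDeriv_exp_sq_zero (v : ℝ) (n : ℕ) :
    iteratedDeriv (n + 2) (fun t => Real.exp (v * t ^ 2 / 2)) 0 =
      v * ((n + 1) * iteratedDeriv n (fun t => Real.exp (v * t ^ 2 / 2)) 0) := by
  have hd : deriv (fun t => Real.exp (v * t ^ 2 / 2)) =
      fun t => v * (t * Real.exp (v * t ^ 2 / 2)) := by
    funext t
    have h : HasDerivAt (fun t : ℝ => v * t ^ 2 / 2) (v * t) t :=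
      (((hasDerivAt_pow 2 t).const_mul v).div_const 2).congr_deriv (by simp; ring)
    rw [h.exp.deriv]
    ring
  have hs : ContDiff ℝ ⊤ fun t : ℝ => Real.exp (v * t ^ 2 / 2) := by fun_prop
  rw [iteratedDeriv_succ', hd, iteratedDeriv_const_mul_field,
    iteratedDeriv_id_mul_zero hs]

/-- The moments of the centred Gaussian distribution. -/
theorem iteratedDeriv_exp_sq_even (v : ℝ) (k : ℕ) :
    iteratedDeriv (2 * k) (fun t => Real.exp (v * t ^ 2 / 2)) 0 =
      (2 * k).factorial / k.factorial * (v / 2) ^ k := by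
  induction k with
  | zero => simp
  | succ k ih =>
    rw [mul_add, mul_one, iteratedDeriv_exp_sq_zero, ih, Nat.factorial_succ (2 * k + 1),
      Nat.factorial_succ (2 * k), Nat.factorial_succ k]
    push_cast
    field_simp
    ring

theorem iteratedDeriv_exp_sq_odd (v : ℝ) (k : ℕ) :
    iteratedDeriv (2 * k + 1) (fun t => Real.exp (v * t ^ 2 / 2)) 0 = 0 := by
  induction k with
  | zero =>
    rw [mul_zero, zero_add, iteratedDeriv_one]
    have h : HasDerivAt (fun t : ℝ => v * t ^ 2 / 2) 0 0 := by
      simpa using ((hasDerivAt_pow 2 (0 : ℝ)).const_mul v).div_const 2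
    simpa using h.exp.deriv
  | succ k ih =>
    have : 2 * (k + 1) + 1 = (2 * k + 1) + 2 := by ring
    rw [this, iteratedDeriv_exp_sq_zero, ih]
    simp

theorem sum_range_eq_sum_even {M : Type*} [AddCommMonoid M] (n : ℕ) (F : ℕ → M)
    (hF : ∀ k, F (2 * k + 1) = 0) :
    ∑ j ∈ Finset.range (n + 1), F j = ∑ k ∈ Finset.range (n / 2 + 1), F (2 * k) := by
  rw [← Finset.sum_image (s := Finset.range (n / 2 + 1)) (g := fun k => 2 * k)
    (fun a _ b _ h => by simpa using h)]
  symm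
  apply Finset.sum_subset
  · intro j hj
    obtain ⟨k, hk, rfl⟩ := Finset.mem_image.1 hj
    rw [Finset.mem_range] at hk ⊢
    omega
  · intro j hj hj'
    rcases Nat.even_or_odd' j with ⟨k, rfl | rfl⟩
    · exact absurd (Finset.mem_image.2 ⟨k, by rw [Finset.mem_range] at hj ⊢; omega, rfl⟩) hj'
    · exact hF k

end Moments

/-! ### Wick powers and S-transforms. -/

namespace NuclearTriple

variable {N : Type*} [AddCommGroup N] [Module ℝ N] [TopologicalSpace N]
  {H : ℕ → Type*} [∀ p, NormedAddCommGroup (H p)] [∀ p, InnerProductSpace ℝ (H p)]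
  [∀ p, CompleteSpace (H p)] {S : NuclearTriple N H}

theorem exists_isHilbertSchmidt_incl (S : NuclearTriple N H) :
    ∃ p, IsHilbertSchmidt (S.incl p) := by
  obtain ⟨p, k, -, hk, -, hHS, -⟩ := S.directed 0 0
  refine ⟨p, ?_⟩
  have : k = S.incl p := by
    ext h
    rw [← hk h, S.incl_zero]
    rfl
  rwa [this] at hHS

/-- The crude bound sⁿ ≤ n! eˢ brings monomials under the theory of Gaussian averages, which then
yields square integrability and S-transforms of Wick powers. -/
theorem isExpBounded_eval_pow (p : ℕ) (ξ : N) (n : ℕ) :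
    S.IsExpBounded p n.factorial ‖S.emb p ξ‖ fun z => z ξ ^ n := by
  refine ⟨norm_nonneg _, fun y z _ _ => ?_, fun z hz => ?_, ?_⟩
  · simp only [add_apply, smul_apply, smul_eq_mul]
    fun_prop
  · rw [norm_pow]
    have h1 := S.norm_apply_le hz ξ
    have h2 := Real.pow_div_factorial_le_exp (x := ‖S.emb p ξ‖ * (S.dualNormC p z).toReal)
      (by positivity) n
    rw [div_le_iff₀ (by positivity), mul_comm (Real.exp _)] at h2
    refine le_trans ?_ h2
    rw [mul_comm ‖S.emb p ξ‖]
    gcongr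
  · exact Measurable.pow_const (isCylMeasurable_eval ξ) n

variable {μ : Measure (TestDual N)} (hμ : S.IsCanonicalGaussian μ)
include hμ

theorem IsCanonicalGaussian.integrable_eval_pow (ξ : N) (n : ℕ) :
    Integrable (fun x : TestDual N => x ξ ^ n) μ :=
  ProbabilityTheory.integrable_pow_of_integrable_exp_mul (t := 1) one_ne_zero
    (hμ.integrable_exp_mul ξ 1) (hμ.integrable_exp_mul ξ (-1)) n

theorem IsCanonicalGaussian.integral_eval_pow (ξ : N) (n : ℕ) :
    ∫ x, x ξ ^ n ∂μ = iteratedDeriv n (fun t => Real.exp (‖S.emb 0 ξ‖ ^ 2 * t ^ 2 / 2)) 0 := by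
  have hset : ProbabilityTheory.integrableExpSet (fun x : TestDual N => x ξ) μ = Set.univ :=
    Set.eq_univ_of_forall fun t => hμ.integrable_exp_mul ξ t
  have h := ProbabilityTheory.iteratedDeriv_mgf_zero (X := fun x : TestDual N => x ξ) (μ := μ)
    (by rw [hset, interior_univ]; trivial) n
  have hmgf : ProbabilityTheory.mgf (fun x : TestDual N => x ξ) μ =
      fun t => Real.exp (‖S.emb 0 ξ‖ ^ 2 * t ^ 2 / 2) := by
    funext t
    rw [ProbabilityTheory.mgf_gaussianReal (hμ.map_eval ξ), Real.coe_toNNReal _ (by positivity)]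
    simp
  rw [hmgf] at h
  exact h.symm

/-- Wick powers as Gaussian averages. -/
theorem IsCanonicalGaussian.imAverage_eval_pow (ξ : N) (n : ℕ) (x : TestDual N) :
    imAverage μ (fun z => z ξ ^ n) x.toComplex = (S.wickPow ξ n x : ℂ) := by
  have h1 : ∀ y : TestDual N, (x.toComplex + Complex.I • y.toComplex) ξ ^ n =
      ∑ j ∈ Finset.range (n + 1),
        Complex.I ^ j * (x ξ : ℂ) ^ (n - j) * n.choose j * ((y ξ ^ j : ℝ) : ℂ) := by
    intro y
    simp only [add_apply, smul_apply, smul_eq_mul, TestDual.toComplex_apply]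
    rw [add_comm, add_pow]
    refine Finset.sum_congr rfl fun j _ => ?_
    rw [mul_pow]
    push_cast
    ring
  have h2 : imAverage μ (fun z => z ξ ^ n) x.toComplex = ∑ j ∈ Finset.range (n + 1),
      Complex.I ^ j * (x ξ : ℂ) ^ (n - j) * n.choose j *
        (iteratedDeriv j (fun t => Real.exp (‖S.emb 0 ξ‖ ^ 2 * t ^ 2 / 2)) 0 : ℝ) := by
    simp only [imAverage, h1]
    rw [integral_finsetSum _ fun j _ => ((hμ.integrable_eval_pow ξ j).ofReal).const_mul _]
    refine Finset.sum_congr rfl fun j _ => ?_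
    rw [integral_const_mul, integral_complex_ofReal, hμ.integral_eval_pow]
  rw [h2, sum_range_eq_sum_even n _ fun k => by rw [iteratedDeriv_exp_sq_odd]; simp, wickPow]
  push_cast
  refine Finset.sum_congr rfl fun k hk => ?_
  have hk' : 2 * k ≤ n := by
    rw [Finset.mem_range] at hk
    omega
  rw [iteratedDeriv_exp_sq_even, Nat.cast_choose ℂ hk', pow_mul, Complex.I_sq]
  have e1 : (-(1 / 2) * (‖S.emb 0 ξ‖ : ℂ) ^ 2) ^ k =
      (-1) ^ k * ((‖S.emb 0 ξ‖ : ℂ) ^ 2 / 2) ^ k := by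
    rw [← mul_pow]
    congr 1
    ring
  rw [e1]
  push_cast
  have f1 : ((2 * k).factorial : ℂ) ≠ 0 := by exact_mod_cast (2 * k).factorial_ne_zero
  have f2 : (k.factorial : ℂ) ≠ 0 := by exact_mod_cast k.factorial_ne_zero
  have f3 : ((n - 2 * k).factorial : ℂ) ≠ 0 := by exact_mod_cast (n - 2 * k).factorial_ne_zero
  field_simp

theorem IsCanonicalGaussian.memLp_wickPow (ξ : N) (n : ℕ) :
    MemLp (fun x => (S.wickPow ξ n x : ℂ)) 2 μ := by
  obtain ⟨p, hp⟩ := S.exists_isHilbertSchmidt_incl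
  have h := (isExpBounded_eval_pow (S := S) p ξ n).memLp_imAverage hμ hp
  simpa only [hμ.imAverage_eval_pow] using h

/-- The `S`-transform of Wick powers. -/
theorem IsCanonicalGaussian.integral_wickPow_mul_exp (ξ η : N) (n : ℕ) :
    ∫ x, (S.wickPow ξ n x : ℂ) * Real.exp (x η - 1 / 2 * ‖S.emb 0 η‖ ^ 2) ∂μ =
      tensorPow (S.emb 0 ξ) n fun _ => S.emb 0 η := by
  obtain ⟨p, hp⟩ := S.exists_isHilbertSchmidt_incl
  have h := (isExpBounded_eval_pow (S := S) p ξ n).integral_imAverage_shift hμ hp η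
  simp only [hμ.imAverage_eval_pow] at h
  rw [hμ.integral_mul_exp η (hμ.memLp_wickPow ξ n).1, h]
  simp [tensorPow, TestDual.toComplex_apply, toDual_apply, real_inner_comm]

/-- The `S`-transform of Wick monomials. -/
theorem IsWickMonomial.integral_mul_exp {n : ℕ} {f : MultilinearMap ℝ (fun _ : Fin n => H 0) ℂ}
    {F : Lp ℂ 2 μ} (hF : S.IsWickMonomial μ f F) (η : N) :
    ∫ x, F x * Real.exp (x η - 1 / 2 * ‖S.emb 0 η‖ ^ 2) ∂μ = f fun _ => S.emb 0 η := by
  let e : TestDual N → ℂ := fun x => (Real.exp (x η - 1 / 2 * ‖S.emb 0 η‖ ^ 2) : ℂ)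
  have he : MemLp e 2 μ := hμ.memLp_exp_mul η _
  have hmul : ∀ {G : TestDual N → ℂ}, MemLp G 2 μ → Integrable (fun x => G x * e x) μ :=
    fun hG => hG.integrable_mul he
  let K₁ := (eLpNorm e 2 μ).toReal
  let K₂ := ‖S.emb 0 η‖ ^ n
  have hK₁ : 0 ≤ K₁ := ENNReal.toReal_nonneg
  have hK₂ : 0 ≤ K₂ := by positivity
  -- Approximating with tolerance t² gives an L² error below t², but a tensor error below t because
  -- that norm enters squared; for t ≤ 1 both are at most t.
  have key : ∀ t : ℝ, 0 < t → t ≤ 1 →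
      ‖∫ x, F x * e x ∂μ - f fun _ => S.emb 0 η‖ ≤ t * (K₁ + K₂) := by
    intro t ht ht1
    obtain ⟨m, c, ξ, h1, h2⟩ := hF (ENNReal.ofReal (t ^ 2)) (by simpa using pow_pos ht 2)
    let W : TestDual N → ℂ := fun x => ∑ j, c j * (S.wickPow (ξ j) n x : ℂ)
    have hW : MemLp W 2 μ := memLp_finsetSum _ fun j _ => (hμ.memLp_wickPow (ξ j) n).const_mul (c j)
    have hFm : MemLp F 2 μ := Lp.memLp F
    have hWe : ∫ x, W x * e x ∂μ = ∑ j, c j * tensorPow (S.emb 0 (ξ j)) n fun _ => S.emb 0 η := by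
      simp only [W, Finset.sum_mul, mul_assoc]
      rw [integral_finsetSum _ fun j _ =>
        (hmul (hμ.memLp_wickPow (ξ j) n)).const_mul (c j)]
      refine Finset.sum_congr rfl fun j _ => ?_
      rw [integral_const_mul, hμ.integral_wickPow_mul_exp]
    have hd : ‖∫ x, (F x - W x) * e x ∂μ‖ ≤ t ^ 2 * K₁ := by
      have h3 : ‖∫ x, (F x - W x) * e x ∂μ‖ₑ ≤ ENNReal.ofReal (t ^ 2) * eLpNorm e 2 μ := by
        refine (enorm_integral_le_lintegral_enorm _).trans ?_
        rw [← eLpNorm_one_eq_lintegral_enorm]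
        refine (eLpNorm_smul_le_mul_eLpNorm (φ := fun x => F x - W x) (f := e) (p := 2) (q := 2)
          (r := 1) he.1 (hFm.1.sub hW.1)).trans ?_
        gcongr
      have h4 := ENNReal.toReal_mono (ENNReal.mul_ne_top ENNReal.ofReal_ne_top he.2.ne) h3
      rwa [toReal_enorm, ENNReal.toReal_mul, ENNReal.toReal_ofReal (by positivity)] at h4
    have hD : ‖(f fun _ => S.emb 0 η) -
        ∑ j, c j * tensorPow (S.emb 0 (ξ j)) n fun _ => S.emb 0 η‖ ≤ t * K₂ := by
      have h3 := norm_le_sqrt_hsNormSq_mul _ (h1.trans ENNReal.ofReal_lt_top) fun _ => S.emb 0 η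
      simp only [sub_apply, sum_apply, smul_apply,
        smul_eq_mul, Finset.prod_const, Finset.card_univ, Fintype.card_fin] at h3
      refine h3.trans ?_
      gcongr
      rw [Real.sqrt_le_left ht.le]
      exact ENNReal.toReal_le_of_le_ofReal (by positivity) h1.le
    have hsplit : ∫ x, F x * e x ∂μ - (f fun _ => S.emb 0 η) =
        ∫ x, (F x - W x) * e x ∂μ - ((f fun _ => S.emb 0 η) -
        ∑ j, c j * tensorPow (S.emb 0 (ξ j)) n fun _ => S.emb 0 η) := by
      simp_rw [sub_mul]
      rw [integral_sub (hmul hFm) (hmul hW), hWe]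
      ring
    rw [hsplit]
    refine (norm_sub_le _ _).trans ((add_le_add hd hD).trans ?_)
    nlinarith [mul_nonneg hK₁ (mul_nonneg ht.le (sub_nonneg.2 ht1))]
  have hzero : ‖∫ x, F x * e x ∂μ - f fun _ => S.emb 0 η‖ ≤ 0 := by
    have hlim : Tendsto (fun t : ℝ => t * (K₁ + K₂)) (𝓝[>] 0) (𝓝 0) := by
      have : Continuous fun t : ℝ => t * (K₁ + K₂) := by fun_prop
      simpa using (this.tendsto 0).mono_left nhdsWithin_le_nhds
    refine ge_of_tendsto hlim ?_
    filter_upwards [Ioc_mem_nhdsGT (zero_lt_one (α := ℝ))] with t ht using key t ht.1 ht.2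
  exact sub_eq_zero.1 (norm_le_zero_iff.1 hzero)

/-- The `S`-transform of a chaos expansion. -/
theorem HasChaos.hasSum_integral_mul_exp {φ : Lp ℂ 2 μ}
    {f : (n : ℕ) → MultilinearMap ℝ (fun _ : Fin n => H 0) ℂ} (hφ : S.HasChaos μ φ f) (η : N) :
    HasSum (fun n => f n fun _ => S.emb 0 η)
      (∫ x, φ x * Real.exp (x η - 1 / 2 * ‖S.emb 0 η‖ ^ 2) ∂μ) := by
  obtain ⟨F, hF, hsum⟩ := hφ
  have he := hμ.memLp_exp_mul η (1 / 2 * ‖S.emb 0 η‖ ^ 2)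
  -- The S-transform at η is an inner product with a fixed element of L²(μ), so it commutes with the
  -- chaos sum.
  have hinner : ∀ G : Lp ℂ 2 μ, innerSL ℂ he.toLp G =
      ∫ x, G x * Real.exp (x η - 1 / 2 * ‖S.emb 0 η‖ ^ 2) ∂μ := by
    intro G
    rw [innerSL_apply_apply, L2.inner_def]
    refine integral_congr_ae ?_
    filter_upwards [he.coeFn_toLp] with x hx
    rw [hx, RCLike.inner_apply, Complex.conj_ofReal]
  have h := hsum.mapL (innerSL ℂ he.toLp)
  simp only [hinner] at h
  simpa only [(hF _).integral_mul_exp hμ] using h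

end NuclearTriple

namespace NuclearTriple

variable {N : Type*} [AddCommGroup N] [Module ℝ N] [TopologicalSpace N]
  {H : ℕ → Type*} [∀ p, NormedAddCommGroup (H p)] [∀ p, InnerProductSpace ℝ (H p)]
  [∀ p, CompleteSpace (H p)] (S : NuclearTriple N H)

/-! ### Comparison of the steps H_{-p} and their union. -/

section Directed

/-- The embedding of `H p` in `H 0` factors through the Hilbert-Schmidt map `k₁` followed by a
contraction, so it is itself Hilbert-Schmidt. -/
theorem exists_dominating (p₁ p₂ : ℕ) : ∃ p, IsHilbertSchmidt (S.incl p) ∧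
    ∃ C : ℝ, 0 ≤ C ∧ ∀ ξ, ‖S.emb p₁ ξ‖ ≤ C * ‖S.emb p ξ‖ ∧ ‖S.emb p₂ ξ‖ ≤ C * ‖S.emb p ξ‖ := by
  obtain ⟨p, k₁, k₂, h₁, h₂, ⟨C, hC⟩, -⟩ := S.directed p₁ p₂
  have e₁ : ∀ ξ, k₁ (S.emb p ξ) = S.emb p₁ ξ := fun ξ =>
    S.incl_injective p₁ (by rw [h₁, S.incl_emb, S.incl_emb])
  have e₂ : ∀ ξ, k₂ (S.emb p ξ) = S.emb p₂ ξ := fun ξ =>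
    S.incl_injective p₂ (by rw [h₂, S.incl_emb, S.incl_emb])
  refine ⟨p, ⟨C, fun m e he => le_trans (Finset.sum_le_sum fun i _ => ?_) (hC m e he)⟩,
    max ‖k₁‖ ‖k₂‖, by positivity, fun ξ => ⟨?_, ?_⟩⟩
  · rw [← h₁]
    gcongr
    exact S.norm_incl_le p₁ _
  · rw [← e₁]
    exact k₁.le_of_opNorm_le (le_max_left _ _) _
  · rw [← e₂]
    exact k₂.le_of_opNorm_le (le_max_right _ _) _

theorem dualNormC_lt_top_and_le {p p' : ℕ} {C : ℝ} (hC : 0 ≤ C)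
    (h : ∀ ξ, ‖S.emb p ξ‖ ≤ C * ‖S.emb p' ξ‖) {z : N →L[ℝ] ℂ} (hz : S.dualNormC p z < ⊤) :
    S.dualNormC p' z < ⊤ ∧ (S.dualNormC p' z).toReal ≤ C * (S.dualNormC p z).toReal := by
  have hreal : ∀ x : TestDual N, S.dualNorm p x < ⊤ →
      S.dualNorm p' x ≤ ENNReal.ofReal C * S.dualNorm p x := by
    intro x hx
    refine iSup₂_le fun ξ hξ => ?_
    rw [← dualNormC_toComplex] at hx ⊢
    have h1 := S.norm_apply_le hx ξ
    rw [TestDual.toComplex_apply, Complex.norm_real] at h1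
    rw [← ENNReal.ofReal_toReal hx.ne, ← ENNReal.ofReal_mul hC, ← ofReal_norm]
    refine ENNReal.ofReal_le_ofReal (h1.trans ?_)
    rw [mul_comm]
    gcongr
    exact (h ξ).trans (mul_le_of_le_one_right hC hξ)
  have hfin : S.dualNorm p (rePart z) < ⊤ ∧ S.dualNorm p (imPart z) < ⊤ := by
    rw [dualNormC, ENNReal.rpow_lt_top_iff_of_pos (by norm_num), ENNReal.add_lt_top] at hz
    simpa using hz
  have hle : S.dualNormC p' z ≤ ENNReal.ofReal C * S.dualNormC p z := by
    have h1 : ENNReal.ofReal C * S.dualNormC p z =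
        ((ENNReal.ofReal C * S.dualNorm p (rePart z)) ^ 2 +
          (ENNReal.ofReal C * S.dualNorm p (imPart z)) ^ 2) ^ (1 / 2 : ℝ) := by
      rw [mul_pow, mul_pow, ← mul_add, ENNReal.mul_rpow_of_nonneg _ _ (by norm_num),
        ← ENNReal.rpow_two, ← ENNReal.rpow_mul]
      norm_num [dualNormC]
    rw [h1, dualNormC]
    gcongr
    · exact hreal _ hfin.1
    · exact hreal _ hfin.2
  have hlt : ENNReal.ofReal C * S.dualNormC p z < ⊤ :=
    ENNReal.mul_lt_top ENNReal.ofReal_lt_top hz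
  refine ⟨hle.trans_lt hlt, ?_⟩
  have h2 := ENNReal.toReal_mono hlt.ne hle
  rwa [ENNReal.toReal_mul, ENNReal.toReal_ofReal hC] at h2

theorem nhds_zero_eq : 𝓝 (0 : N) = ⨅ p, Filter.comap (S.emb p) (𝓝 0) := by
  have h := congrArg (fun t : TopologicalSpace N => @nhds N t 0) S.topology_eq
  simp only [nhds_iInf, nhds_induced, map_zero] at h
  exact h

/-- `N'_c` is the union of the spaces `H_{-p,c}`. -/
theorem exists_dualNormC_lt_top (z : N →L[ℝ] ℂ) :
    ∃ p, IsHilbertSchmidt (S.incl p) ∧ S.dualNormC p z < ⊤ := by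
  -- Directedness makes a single seminorm suffice in a basic neighbourhood of 0, so a continuous
  -- functional is bounded by one |·|_p.
  have hdir : Directed (· ≥ ·) fun p => Filter.comap (S.emb p) (𝓝 0) := by
    intro p₁ p₂
    obtain ⟨p, -, C, hC, h⟩ := S.exists_dominating p₁ p₂
    have key : ∀ p', (∀ ξ, ‖S.emb p' ξ‖ ≤ C * ‖S.emb p ξ‖) →
        Filter.comap (S.emb p) (𝓝 0) ≤ Filter.comap (S.emb p') (𝓝 0) := by
      intro p' h'
      rw [← Filter.tendsto_iff_comap]
      have h1 : Tendsto (fun ξ => C * ‖S.emb p ξ‖) (Filter.comap (S.emb p) (𝓝 0)) (𝓝 0) := by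
        have h2 : Tendsto (S.emb p) (Filter.comap (S.emb p) (𝓝 0)) (𝓝 0) := Filter.tendsto_comap
        simpa using h2.norm.const_mul C
      exact squeeze_zero_norm h' h1
    exact ⟨p, key p₁ fun ξ => (h ξ).1, key p₂ fun ξ => (h ξ).2⟩
  have hball : {ξ : N | ‖z ξ‖ < 1} ∈ 𝓝 (0 : N) := by
    have : Continuous fun ξ => ‖z ξ‖ := by fun_prop
    exact (this.tendsto 0).eventually_lt_const (by simp)
  rw [S.nhds_zero_eq, Filter.mem_iInf_of_directed hdir] at hball
  obtain ⟨p₀, A, hA, hsub⟩ := hball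
  obtain ⟨r, hr, hrA⟩ := Metric.mem_nhds_iff.1 hA
  have hle : ∀ ξ, ‖S.emb p₀ ξ‖ ≤ 1 → ‖z ξ‖ ≤ 2 / r := by
    intro ξ hξ
    have h1 : (r / 2) • ξ ∈ {ξ : N | ‖z ξ‖ < 1} := by
      apply hsub
      apply hrA
      rw [mem_ball_zero_iff, map_smul, norm_smul, Real.norm_of_nonneg (by positivity)]
      nlinarith
    rw [Set.mem_ofPred_eq, map_smul, norm_smul, Real.norm_of_nonneg (by positivity)] at h1
    rw [le_div_iff₀ hr]
    linarith
  have hfin : ∀ x : TestDual N, (∀ ξ, |x ξ| ≤ ‖z ξ‖) → S.dualNorm p₀ x < ⊤ := by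
    intro x hx
    refine lt_of_le_of_lt (b := ENNReal.ofReal (2 / r)) (iSup₂_le fun ξ hξ => ?_) (by simp)
    rw [← ofReal_norm]
    exact ENNReal.ofReal_le_ofReal ((hx ξ).trans (hle ξ hξ))
  have hz : S.dualNormC p₀ z < ⊤ := by
    rw [dualNormC, ENNReal.rpow_lt_top_iff_of_pos (by norm_num), ENNReal.add_lt_top]
    exact ⟨ENNReal.pow_lt_top (hfin _ fun ξ => Complex.abs_re_le_norm (z ξ)),
      ENNReal.pow_lt_top (hfin _ fun ξ => Complex.abs_im_le_norm (z ξ))⟩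
  obtain ⟨p, hp, C, hC, h⟩ := S.exists_dominating p₀ p₀
  exact ⟨p, hp, (S.dualNormC_lt_top_and_le hC (fun ξ => (h ξ).1) hz).1⟩

end Directed

/-! ### Construction of the pointwise version. -/

variable {S}

theorem isEntireOn_of_norm_le {p : ℕ} {G : (N →L[ℝ] ℂ) → ℂ}
    (hd : ∀ y z : N →L[ℝ] ℂ, S.dualNormC p y < ⊤ → S.dualNormC p z < ⊤ →
      Differentiable ℂ fun t : ℂ => G (y + t • z)) {C ε : ℝ} (hC : 0 ≤ C) (hε : 0 ≤ ε)
    (hb : ∀ z, S.dualNormC p z < ⊤ → ‖G z‖ ≤ C * Real.exp (ε * (S.dualNormC p z).toReal)) :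
    S.IsEntireOn p G := by
  refine ⟨hd, fun y hy => ⟨1, one_pos, C * Real.exp (ε * ((S.dualNormC p y).toReal + 1)),
    fun z hz => ?_⟩⟩
  have hz' : S.dualNormC p (z - y) < ⊤ := hz.trans ENNReal.one_lt_top
  have hzy : z = y + (1 : ℂ) • (z - y) := by ext; simp
  have h1 : S.dualNormC p z < ⊤ := by
    rw [hzy]
    exact S.dualNormC_add_smul_lt_top hy hz' 1
  refine (hb z h1).trans ?_
  gcongr
  have h2 := S.toReal_dualNormC_add_smul_le hy hz' 1
  rw [← hzy, norm_one, one_mul] at h2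
  refine h2.trans ?_
  gcongr
  simpa using ENNReal.toReal_mono ENNReal.one_ne_top hz.le

theorem IsTestFunction.testNormSq_lt_top {μ : Measure (TestDual N)} {φ : Lp ℂ 2 μ}
    {f : (n : ℕ) → MultilinearMap ℝ (fun _ : Fin n => H 0) ℂ} (hφ : S.IsTestFunction μ φ f)
    (p : ℕ) (q : ℝ) : S.testNormSq p q f < ⊤ :=
  (S.testNormSq_mono p (Nat.le_ceil q) f).trans_lt (hφ.2 p _)

/-- The version of a test function on the complexification of `H_{-p}`. -/
theorem IsTestFunction.exists_version_on {μ : Measure (TestDual N)}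
    (hμ : S.IsCanonicalGaussian μ) {φ : Lp ℂ 2 μ}
    {f : (n : ℕ) → MultilinearMap ℝ (fun _ : Fin n => H 0) ℂ} (hφ : S.IsTestFunction μ φ f)
    {p : ℕ} (hp : IsHilbertSchmidt (S.incl p)) :
    ∃ U : (N →L[ℝ] ℂ) → ℂ,
      (∀ y z : N →L[ℝ] ℂ, S.dualNormC p y < ⊤ → S.dualNormC p z < ⊤ →
        Differentiable ℂ fun t : ℂ => U (y + t • z)) ∧
      (∀ᵐ x ∂μ, U x.toComplex = φ x) ∧
      ∀ q : ℝ, ∀ z, S.dualNormC p z < ⊤ →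
        ‖U z‖ ≤ √(S.testNormSq p q f).toReal *
          Real.exp (2 ^ (-q / 2) * (S.dualNormC p z).toReal) *
            ∫ y, Real.exp (2 ^ (-q / 2) * (S.dualNorm p y).toReal) ∂μ := by
  obtain ⟨ι, hι, ⟨B⟩⟩ := S.exists_adaptedBasis p
  -- The kernels, and hence the function built from them, do not depend on q; q = 0 only witnesses
  -- finiteness. One function therefore satisfies the bounds for all q.
  choose g hfg hgk hg using fun n =>
    S.exists_hsNormSq_eq_kernelNormSq (S.kernelNormSq_lt_top (hφ.testNormSq_lt_top p 0) n)
  have hbound : ∀ q : ℝ, ∀ n, √(hsNormSq (g n)).toReal ≤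
      √(S.testNormSq p q f).toReal * (((2 : ℝ) ^ (-q / 2)) ^ n / n.factorial) := by
    intro q n
    rw [hgk]
    exact S.sqrt_kernelNormSq_le (hφ.testNormSq_lt_top p q) n
  have hG := fun q : ℝ => isExpBounded_kernelSeries B hg (hbound q) (by positivity)
  refine ⟨imAverage μ (kernelSeries B g),
    fun y z hy hz => (hG 0).differentiable_imAverage hμ hp hy hz, ?_,
    fun q z hz => (hG q).norm_imAverage_le hμ hp hz⟩
  have hU := (hG 0).memLp_imAverage hμ hp
  have hzero := hμ.ae_eq_zero_of_integral_mul_exp (hU.sub (Lp.memLp φ)) fun η => ?_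
  · filter_upwards [hzero] with x hx
    exact sub_eq_zero.1 hx
  · have he := hμ.memLp_exp_mul η (1 / 2 * ‖S.emb 0 η‖ ^ 2)
    have h1 : ∫ x, imAverage μ (kernelSeries B g) x.toComplex *
        Real.exp (x η - 1 / 2 * ‖S.emb 0 η‖ ^ 2) ∂μ =
        ∫ x, φ x * Real.exp (x η - 1 / 2 * ‖S.emb 0 η‖ ^ 2) ∂μ := by
      rw [hμ.integral_mul_exp η hU.1, (hG 0).integral_imAverage_shift hμ hp]
      refine HasSum.unique ?_ (hφ.1.hasSum_integral_mul_exp hμ η)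
      -- The adjoint of the embedding sends η to its Riesz representative in `H p`, where `g n`
      -- takes the value of `f n` at η.
      have h2 := hasSum_kernelSeries_of_inner B hg (hbound 0) (x := S.toDual η)
        (v := ContinuousLinearMap.adjoint (S.incl p) (S.emb 0 η)) fun ξ => by
          rw [ContinuousLinearMap.adjoint_inner_left, S.incl_emb, toDual_apply]
      convert h2 using 2 with n
      rw [hfg n]
      rfl
    simp only [Pi.sub_apply, sub_mul]
    rw [← sub_eq_zero, ← integral_sub] at h1
    · exact h1
    · exact hU.integrable_mul he
    · exact (Lp.memLp φ).integrable_mul he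

end NuclearTriple

end GaussianAnalysis

end

open GaussianAnalysis in
theorem mainTheorem4 {N : Type*} [AddCommGroup N] [Module ℝ N] [TopologicalSpace N]
    {H : ℕ → Type*} [∀ p, NormedAddCommGroup (H p)] [∀ p, InnerProductSpace ℝ (H p)]
    [∀ p, CompleteSpace (H p)] (S : NuclearTriple N H)
    (μ : Measure (TestDual N)) (hμ : S.IsCanonicalGaussian μ)
    (φ : Lp ℂ 2 μ) (f : (n : ℕ) → MultilinearMap ℝ (fun _ : Fin n => H 0) ℂ)
    (hφ : S.IsTestFunction μ φ f) :
    (∃ u, S.IsPointwiseVersion μ φ u) ∧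
    ∀ u, S.IsPointwiseVersion μ φ u →
      ∀ p : ℕ, IsHilbertSchmidt (S.incl p) → ∀ q : ℝ, 0 ≤ q → ∀ ε : ℝ, ε = 2 ^ (-q / 2) →
        S.expConst μ p ε < ⊤ ∧
        ∀ x : TestDual N, S.dualNorm p x < ⊤ →
          ‖u x.toComplex‖ ≤ (S.expConst μ p ε).toReal * √(S.testNormSq p q f).toReal *
            Real.exp (ε * (S.dualNorm p x).toReal) := by
  classical
  choose U hUd hUae hUb using
    fun (p : {p // IsHilbertSchmidt (S.incl p)}) => hφ.exists_version_on hμ p.2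
  have hI : ∀ (p : ℕ) (ε : ℝ), 0 ≤ ∫ y, Real.exp (ε * (S.dualNorm p y).toReal) ∂μ := fun p ε =>
    integral_nonneg fun _ => (Real.exp_pos _).le
  have hUE : ∀ p : {p // IsHilbertSchmidt (S.incl p)}, S.IsEntireOn p (U p) := by
    intro p
    refine NuclearTriple.isEntireOn_of_norm_le (hUd p)
      (C := √(S.testNormSq p 0 f).toReal *
        ∫ y, Real.exp (2 ^ (-(0 : ℝ) / 2) * (S.dualNorm p y).toReal) ∂μ)
      (ε := 2 ^ (-(0 : ℝ) / 2))
      (mul_nonneg (Real.sqrt_nonneg _) (hI p _)) (by positivity)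
      fun z hz => (hUb p 0 z hz).trans_eq ?_
    ring
  -- comparison of the versions on different spaces
  have hmono : ∀ (p p' : {p // IsHilbertSchmidt (S.incl p)}) (C : ℝ), 0 ≤ C →
      (∀ ξ, ‖S.emb p ξ‖ ≤ C * ‖S.emb p' ξ‖) → ∀ z, S.dualNormC p z < ⊤ → U p z = U p' z := by
    intro p p' C hC h z hz
    -- Here H_{-p} ⊂ H_{-p'} continuously, so both versions are entire on H_{-p,c}, and both agree
    -- almost everywhere with φ.
    have hE : S.IsEntireOn p (U p') := by
      refine NuclearTriple.isEntireOn_of_norm_le (fun y z hy hz => hUd p' y z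
        (S.dualNormC_lt_top_and_le hC h hy).1 (S.dualNormC_lt_top_and_le hC h hz).1)
        (C := √(S.testNormSq p' 0 f).toReal *
          ∫ y, Real.exp (2 ^ (-(0 : ℝ) / 2) * (S.dualNorm p' y).toReal) ∂μ)
        (ε := 2 ^ (-(0 : ℝ) / 2) * C)
        (mul_nonneg (Real.sqrt_nonneg _) (hI p' _)) (by positivity) fun z hz => ?_
      obtain ⟨h1, h2⟩ := S.dualNormC_lt_top_and_le hC h hz
      refine (hUb p' 0 z h1).trans ?_
      rw [mul_right_comm, mul_assoc (2 ^ (-(0 : ℝ) / 2)) C]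
      have := hI p' (2 ^ (-(0 : ℝ) / 2))
      gcongr
    refine (hUE p).eq_of_ae hμ p.2 hE ?_ hz
    filter_upwards [hUae p, hUae p'] with x h1 h2
    rw [h1, h2]
  choose P hPHS hP using S.exists_dualNormC_lt_top
  -- The choice of step for each z is harmless: any two steps lie in a common larger one, on which
  -- `hmono` compares the versions.
  let u : (N →L[ℝ] ℂ) → ℂ := fun z => U ⟨P z, hPHS z⟩ z
  have hu : ∀ (p : {p // IsHilbertSchmidt (S.incl p)}) (z : N →L[ℝ] ℂ),
      S.dualNormC p z < ⊤ → u z = U p z := by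
    intro p z hz
    obtain ⟨p', hp', C, hC, h⟩ := S.exists_dominating p (P z)
    rw [hmono p ⟨p', hp'⟩ C hC (fun ξ => (h ξ).1) z hz]
    exact hmono ⟨P z, hPHS z⟩ ⟨p', hp'⟩ C hC (fun ξ => (h ξ).2) z (hP z)
  -- growth on every step
  have hgrowth : ∀ (p : ℕ) (ε : ℝ), 0 < ε → ∃ C : ℝ, 0 ≤ C ∧ ∀ z, S.dualNormC p z < ⊤ →
      ‖u z‖ ≤ C * Real.exp (ε * (S.dualNormC p z).toReal) := by
    intro p ε hε
    obtain ⟨p', hp', K, hK, h⟩ := S.exists_dominating p p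
    -- With q = 2m the exponent on `p'` is 2^{-m}; returning to |·|_{-p} costs the factor `K`, so a
    -- large m gives any prescribed type.
    obtain ⟨m, hm⟩ : ∃ m : ℕ, (1 / 2 : ℝ) ^ m * K < ε := by
      have hlim := (tendsto_pow_atTop_nhds_zero_of_lt_one (r := (1 / 2 : ℝ)) (by norm_num)
        (by norm_num)).mul_const K
      rw [zero_mul] at hlim
      exact (hlim.eventually_lt_const hε).exists
    let q : ℝ := 2 * m
    have hq : (2 : ℝ) ^ (-q / 2) = (1 / 2 : ℝ) ^ m := by
      have : -q / 2 = -(m : ℝ) := by simp only [q]; ring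
      rw [this, Real.rpow_neg (by norm_num), Real.rpow_natCast, one_div, inv_pow]
    refine ⟨√(S.testNormSq p' q f).toReal *
      ∫ y, Real.exp (2 ^ (-q / 2) * (S.dualNorm p' y).toReal) ∂μ,
      mul_nonneg (Real.sqrt_nonneg _) (hI p' _), fun z hz => ?_⟩
    obtain ⟨h1, h2⟩ := S.dualNormC_lt_top_and_le hK (fun ξ => (h ξ).1) hz
    rw [hu ⟨p', hp'⟩ z h1]
    refine (hUb ⟨p', hp'⟩ q z h1).trans ?_
    rw [mul_right_comm]
    have := hI p' (2 ^ (-q / 2))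
    gcongr ?_ * Real.exp ?_
    calc (2 : ℝ) ^ (-q / 2) * (S.dualNormC p' z).toReal
        ≤ (1 / 2 : ℝ) ^ m * (K * (S.dualNormC p z).toReal) := by rw [hq]; gcongr
      _ = (1 / 2 : ℝ) ^ m * K * (S.dualNormC p z).toReal := by ring
      _ ≤ ε * (S.dualNormC p z).toReal := by gcongr
  have hdiff : ∀ y z : N →L[ℝ] ℂ, Differentiable ℂ fun t : ℂ => u (y + t • z) := by
    intro y z
    obtain ⟨p, hp, C, hC, h⟩ := S.exists_dominating (P y) (P z)
    have hy := (S.dualNormC_lt_top_and_le hC (fun ξ => (h ξ).1) (hP y)).1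
    have hz := (S.dualNormC_lt_top_and_le hC (fun ξ => (h ξ).2) (hP z)).1
    have heq : (fun t : ℂ => u (y + t • z)) = fun t : ℂ => U ⟨p, hp⟩ (y + t • z) :=
      funext fun t => hu ⟨p, hp⟩ _ (S.dualNormC_add_smul_lt_top hy hz t)
    rw [heq]
    exact hUd ⟨p, hp⟩ y z hy hz
  refine ⟨⟨u, ⟨⟨hdiff, fun p => ?_⟩, fun p ε hε => ?_⟩, ?_⟩, ?_⟩
  · obtain ⟨C, hC, hb⟩ := hgrowth p 1 one_pos
    exact (NuclearTriple.isEntireOn_of_norm_le (fun y z _ _ => hdiff y z) hC zero_le_one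
      hb).locally_bounded
  · obtain ⟨C, -, hb⟩ := hgrowth p ε hε
    exact ⟨C, hb⟩
  · obtain ⟨p, hp⟩ := S.exists_isHilbertSchmidt_incl
    filter_upwards [hμ.ae_dualNorm_lt_top hp, hUae ⟨p, hp⟩] with x hx h1
    rw [← h1]
    exact hu ⟨p, hp⟩ _ (by rwa [NuclearTriple.dualNormC_toComplex])
  · rintro v ⟨⟨⟨hvd, hvb⟩, -⟩, hvae⟩ p hp q - ε rfl
    rw [hμ.expConst_eq hp]
    refine ⟨ENNReal.ofReal_lt_top, fun x hx => ?_⟩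
    have hx' : S.dualNormC p x.toComplex < ⊤ := by rwa [NuclearTriple.dualNormC_toComplex]
    have hv : S.IsEntireOn p v := ⟨fun y z _ _ => hvd y z, hvb p⟩
    -- Uniqueness on H_{-p} transfers the bound from the constructed version to an arbitrary one, at
    -- every point rather than almost every point.
    have heq : v x.toComplex = U ⟨p, hp⟩ x.toComplex := by
      refine hv.eq_of_ae hμ hp (hUE ⟨p, hp⟩) ?_ hx'
      filter_upwards [hvae, hUae ⟨p, hp⟩] with y h1 h2
      rw [h1, h2]
    rw [heq, ENNReal.toReal_ofReal (hI p _)]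
    refine (hUb ⟨p, hp⟩ q _ hx').trans_eq ?_
    rw [NuclearTriple.dualNormC_toComplex]
    ring
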